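/- Let $p$ be a prime, let $k$ be an algebraic closure of $\mathbb{Z}/p$, let $G$ be a finite group and let $H$ be a subgroup of $G$. Let $H\text{-Proj}$ be the class of $H$-projective $kG$-modules, that is, of all direct summands of modules $\operatorname{Ind}_H^G(N)$ induced from (arbitrary) $kH$-modules $N$, and let $\operatorname{K}(H\text{-Proj})$ be the homotopy category of (unbounded) complexes of $H$-projective modules. Let $\operatorname{Tate}_H(kG)$ be the full triangulated subcategory of $\operatorname{K}(H\text{-Proj})$ whose objects are the complexes $X$ for which the restriction $\operatorname{Res}^G_H(X)$ is split exact. Let $\operatorname{StMod}_H(kG)$ be the relative stable module category, which has all $kG$-modules as objects and whose morphisms are the $kG$-homomorphisms modulo those that factor through an $H$-projective module. The category $\operatorname{StMod}_H(kG)$ is triangulated in the standard way: its suspension functor $\Sigma$ is induced by $M \mapsto \operatorname{Coker}\bigl(M \to \operatorname{CoInd}_H^G\operatorname{Res}^G_H M\bigr)$, the map being the canonical embedding (and $\operatorname{CoInd}_H^G\cong\operatorname{Ind}_H^G$), and its distinguished triangles are those isomorphic to the triangles $A \xrightarrow{f} B \xrightarrow{g} C \xrightarrow{w} \Sigma A$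 that come from the short exact sequences $0\to A\xrightarrow{f} B\xrightarrow{g} C\to 0$ of $kG$-modules which split on restriction to $H$; here $w$ is induced by any extension $B \to \operatorname{CoInd}_H^G\operatorname{Res}^G_H A$ of the canonical embedding of $A$. The functor $$\operatorname{Z}^0 : \operatorname{Tate}_H(kG) \longrightarrow \operatorname{StMod}_H(kG), \qquad X \longmapsto \operatorname{Z}^0(X) = \operatorname{Ker}(X^0 \to X^1),$$ is well defined and is a triangulated equivalence: together with a suitable natural isomorphism that commutes it with the suspensions, it sends distinguished triangles to distinguished triangles, and it is an equivalence of categories. -/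

import Mathlib

open CategoryTheory Limits Pretriangulated
open scoped ZeroObject

universe u

namespace RelStable

section SplitExact

variable {C : Type*} [Category C] [Abelian C]

/-- A cochain complex `K` is split exact if it is exact and split, the latter meaning that for
each differential `d` there is a map `s` in the opposite direction with `d s d = d`. -/
def IsSplitExact (K : CochainComplex C ℤ) : Prop :=
  K.Acyclic ∧ ∀ i j : ℤ, ∃ s : K.X j ⟶ K.X i, K.d i j ≫ s ≫ K.d i j = K.d i j

/-- Split exactness amounts to contractibility. -/
theorem isSplitExact_iff (K : CochainComplex C ℤ) :
    IsSplitExact K ↔ Nonempty (Homotopy (𝟙 K) 0) := by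
  constructor
  · rintro ⟨hK, hs⟩
    choose s hs using hs
    refine ⟨⟨fun i j => if j + 1 = i then s j i - K.d i (i + 1) ≫ s i (i + 1) ≫ s j i else 0,
      fun i j hij => if_neg hij, fun i => ?_⟩⟩
    obtain ⟨j, rfl⟩ : ∃ j, i = j + 1 := ⟨i - 1, by omega⟩
    have hex : (K.sc' j (j + 1) (j + 1 + 1)).Exact :=
      (HomologicalComplex.exactAt_iff' K j (j + 1) (j + 1 + 1) (by simp) (by simp)).1 (hK (j + 1))
    have h0 := hex.comp_eq_zero
      (a := 𝟙 _ - K.d (j + 1) (j + 1 + 1) ≫ s (j + 1) (j + 1 + 1))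
      (b := 𝟙 _ - s j (j + 1) ≫ K.d j (j + 1))
      (by change (_ - _) ≫ K.d (j + 1) (j + 1 + 1) = 0
          simp [hs])
      (by change K.d j (j + 1) ≫ (_ - _) = 0
          simp [hs])
    replace h0 : (𝟙 (K.X (j + 1)) - K.d (j + 1) (j + 1 + 1) ≫ s (j + 1) (j + 1 + 1)) ≫
      (𝟙 (K.X (j + 1)) - s j (j + 1) ≫ K.d j (j + 1)) = 0 := h0
    rw [Preadditive.comp_sub, Preadditive.sub_comp, Preadditive.sub_comp] at h0
    rw [dNext_eq _ (show (ComplexShape.up ℤ).Rel (j + 1) (j + 1 + 1) from rfl),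
      prevD_eq _ (show (ComplexShape.up ℤ).Rel j (j + 1) from rfl)]
    simp only [HomologicalComplex.id_f, HomologicalComplex.zero_f, add_zero, if_true,
      Preadditive.comp_sub, Preadditive.sub_comp, Category.assoc, Category.id_comp, Category.comp_id,
      HomologicalComplex.d_comp_d_assoc, zero_comp, sub_zero] at h0 ⊢
    rw [← sub_eq_zero, ← h0]
    abel
  · rintro ⟨h⟩
    refine ⟨fun i => ?_, fun i j => ?_⟩
    · rw [HomologicalComplex.exactAt_iff_isZero_homology, IsZero.iff_id_eq_zero,
        ← HomologicalComplex.homologyMap_id, h.homologyMap_eq i,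
        HomologicalComplex.homologyMap_zero]
    · by_cases hij : (ComplexShape.up ℤ).Rel i j
      · refine ⟨h.hom j i, ?_⟩
        have := h.comm i
        rw [dNext_eq _ hij] at this
        simp only [HomologicalComplex.id_f, HomologicalComplex.zero_f, add_zero] at this
        have h2 := congrArg (· ≫ K.d i j) this
        have hp : prevD i h.hom = h.hom i (i - 1) ≫ K.d (i - 1) i :=
          prevD_eq _ (show (ComplexShape.up ℤ).Rel (i - 1) i by simp)
        rw [hp] at h2
        simpa using h2.symm
      · exact ⟨0, by simp [K.shape i j hij]⟩

/-- Homotopic maps differ on cocycles by a map which factors through a term of the complex. -/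
theorem cyclesMap_sub_of_homotopy {K L : CochainComplex C ℤ} {f g : K ⟶ L} (h : Homotopy f g) :
    K.iCycles 0 ≫ h.hom 0 (-1) ≫ L.toCycles (-1) 0 =
      HomologicalComplex.cyclesMap f 0 - HomologicalComplex.cyclesMap g 0 := by
  have h1 := h.comm 0
  rw [dNext_eq _ (show (ComplexShape.up ℤ).Rel 0 1 by simp),
    prevD_eq _ (show (ComplexShape.up ℤ).Rel (-1) 0 by simp)] at h1
  rw [← cancel_mono (L.iCycles 0), Preadditive.sub_comp, HomologicalComplex.cyclesMap_i,
    HomologicalComplex.cyclesMap_i, h1]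
  simp

end SplitExact

section

variable (k : Type u) [CommRing k] {G : Type u} [Group G] (H : Subgroup G)

/-- Restriction of `kG`-modules to `kH`. Here `Mod(kG)` is the category `Rep k G` of `k`-linear
representations of `G`. -/
noncomputable abbrev resH : Rep.{u} k G ⥤ Rep.{u} k H := Rep.resFunctor H.subtype

/-- The class `H`-Proj: the direct summands of modules `Ind N` induced from `kH`-modules `N`. -/
def isHProj : ObjectProperty (Rep.{u} k G) := fun M =>
  ∃ N : Rep.{u} k H, Nonempty (Retract M ((Rep.indFunctor k H.subtype).obj N))

/-- `H`-Proj as a full subcategory of the category of `kG`-modules. -/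
abbrev HProj := (isHProj k H).FullSubcategory

instance : (Rep.indFunctor.{u} k H.subtype).Additive :=
  (Rep.indResAdjunction.{u} k H.subtype).left_adjoint_additive

instance : (isHProj k H).IsStableUnderRetracts where
  of_retract r := fun ⟨N, ⟨r'⟩⟩ => ⟨N, ⟨r.trans r'⟩⟩

instance : (isHProj k H).Nonempty :=
  ObjectProperty.nonempty_of_prop (P := isHProj k H)
    (X := (Rep.indFunctor k H.subtype).obj (0 : Rep.{u} k H))
    ⟨_, ⟨Retract.refl _⟩⟩

theorem isHProj_biprod {M₁ M₂ : Rep.{u} k G} (h₁ : isHProj k H M₁) (h₂ : isHProj k H M₂) :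
    isHProj k H (M₁ ⊞ M₂) := by
  obtain ⟨N₁, ⟨r₁⟩⟩ := h₁
  obtain ⟨N₂, ⟨r₂⟩⟩ := h₂
  have : PreservesBinaryBiproduct N₁ N₂ (Rep.indFunctor.{u} k H.subtype) :=
    preservesBinaryBiproduct_of_preservesBiproduct _ _ _
  refine ⟨N₁ ⊞ N₂, ⟨Retract.trans (Y := (Rep.indFunctor.{u} k H.subtype).obj N₁ ⊞
    (Rep.indFunctor.{u} k H.subtype).obj N₂) ⟨biprod.map r₁.i r₂.i, biprod.map r₁.r r₂.r, ?_⟩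
    (Retract.ofIso ((Rep.indFunctor.{u} k H.subtype).mapBiprod N₁ N₂).symm)⟩⟩
  refine biprod.hom_ext _ _ ?_ ?_ <;> simp

instance : (isHProj k H).IsClosedUnderBinaryProducts where
  limitsOfShape_le := by
    rintro X ⟨p⟩
    exact (isHProj k H).prop_of_iso
      (IsLimit.conePointsIsoOfNatIso (BinaryBiproduct.isLimit _ _) p.isLimit
        (diagramIsoPair p.diag).symm)
      (isHProj_biprod k H (p.prop_diag_obj ⟨.left⟩) (p.prop_diag_obj ⟨.right⟩))

instance : (isHProj k H).IsClosedUnderFiniteProducts :=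
  ObjectProperty.IsClosedUnderFiniteProducts.mk'

instance : HasFiniteBiproducts (HProj k H) := HasFiniteBiproducts.of_hasFiniteProducts

instance : HasBinaryBiproducts (HProj k H) := hasBinaryBiproducts_of_finite_biproducts _

/-- `K(H-Proj)`: the homotopy category of complexes of `H`-projective modules, with Mathlib's
triangulated structure on homotopy categories. -/
abbrev KHProj := HomotopyCategory (HProj k H) (ComplexShape.up ℤ)

/-- The complex of `kG`-modules underlying a complex of `H`-projective modules. -/
noncomputable abbrev underlying :
    CochainComplex (HProj k H) ℤ ⥤ CochainComplex (Rep.{u} k G) ℤ :=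
  (isHProj k H).ι.mapHomologicalComplex (ComplexShape.up ℤ)

/-- The restriction functor from `K(H-Proj)` to `K(kH)`. -/
noncomputable abbrev resK : KHProj k H ⥤ HomotopyCategory (Rep.{u} k H) (ComplexShape.up ℤ) :=
  ((isHProj k H).ι ⋙ resH k H).mapHomotopyCategory (ComplexShape.up ℤ)

/-- The complexes of `H`-projective modules whose restriction to `H` is split exact. -/
def isTate : ObjectProperty (KHProj k H) := fun Q =>
  IsSplitExact (((resH k H).mapHomologicalComplex (ComplexShape.up ℤ)).obj
    ((underlying k H).obj Q.as))

theorem isTate_eq : isTate k H =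
    ObjectProperty.inverseImage (IsZero (C := HomotopyCategory (Rep.{u} k H) (ComplexShape.up ℤ)))
      (resK k H) := by
  ext Q
  exact (isSplitExact_iff _).trans (HomotopyCategory.isZero_quotient_obj_iff _).symm

instance : (isTate k H).IsTriangulated := by
  have : (ObjectProperty.IsTriangulated
    (IsZero (C := HomotopyCategory (Rep.{u} k H) (ComplexShape.up ℤ)))) :=
    { exists_zero := ⟨0, isZero_zero _, isZero_zero _⟩
      isStableUnderShiftBy := fun a => ⟨fun _ hX => (shiftFunctor _ a).map_isZero hX⟩
      toIsTriangulatedClosed₂ := .mk' fun T hT h₁ h₃ => T.isZero₂_of_isZero₁₃ hT h₁ h₃ }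
  rw [isTate_eq]
  infer_instance

/-- `Tate_H(kG)`, as a full triangulated subcategory of `K(H-Proj)`; its triangulated structure is
the one induced from `K(H-Proj)`. -/
abbrev Tate := (isTate k H).FullSubcategory

/-- The congruence on `kG`-modules: `f ~ g` if `f - g` factors through an `H`-projective. -/
def stableRel : HomRel (Rep.{u} k G) := fun X Y f g =>
  ∃ (P : Rep.{u} k G) (_ : isHProj k H P) (a : X ⟶ P) (b : P ⟶ Y), a ≫ b = f - g

instance : Congruence (stableRel k H) where
  comp_left f _ _ := fun ⟨P, hP, a, b, h⟩ => ⟨P, hP, f ≫ a, b, by simp [h]⟩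
  comp_right g h := by
    obtain ⟨P, hP, a, b, h⟩ := h
    exact ⟨P, hP, a, b ≫ g, by simp [reassoc_of% h]⟩
  equivalence :=
    { refl := fun f => ⟨0, ObjectProperty.prop_zero _, 0, 0, by simp⟩
      symm := fun ⟨P, hP, a, b, h⟩ => ⟨P, hP, a, -b, by simp [h]⟩
      trans := fun ⟨P, hP, a, b, h⟩ ⟨Q, hQ, a', b', h'⟩ =>
        ⟨P ⊞ Q, isHProj_biprod k H hP hQ, biprod.lift a a', biprod.desc b b', by
          simp [h, h']⟩ }

/-- The relative stable module category `StMod_H(kG)`: all `kG`-modules, with the homomorphisms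
taken modulo those that factor through an `H`-projective module. -/
abbrev StMod := CategoryTheory.Quotient (stableRel k H)

/-- The projection functor from `Mod(kG)` to `StMod_H(kG)`. -/
abbrev toStMod : Rep.{u} k G ⥤ StMod k H := CategoryTheory.Quotient.functor (stableRel k H)

noncomputable instance : Preadditive (StMod k H) :=
  CategoryTheory.Quotient.preadditive _ (by
    rintro X Y f₁ f₂ g₁ g₂ ⟨P, hP, a, b, h⟩ ⟨Q, hQ, a', b', h'⟩
    exact ⟨P ⊞ Q, isHProj_biprod k H hP hQ, biprod.lift a a', biprod.desc b b', by
      simp [h, h']; abel⟩)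

instance : (toStMod k H).Additive where
  map_add := rfl

instance : HasZeroObject (StMod k H) :=
  ⟨(toStMod k H).obj 0, (toStMod k H).map_isZero (isZero_zero _)⟩

/-- The functor `X ↦ Z⁰(X)` from `K(H-Proj)` to `StMod_H(kG)`, where
`Z⁰(X) = ker (X⁰ ⟶ X¹)`. -/
noncomputable def cyclesZero : KHProj k H ⥤ StMod k H :=
  CategoryTheory.Quotient.lift _
    (underlying k H ⋙ HomologicalComplex.cyclesFunctor (Rep.{u} k G) (ComplexShape.up ℤ) 0 ⋙
      toStMod k H)
    (by
      rintro X Y f g ⟨h⟩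
      refine CategoryTheory.Quotient.sound _ ?_
      exact ⟨_, (X.X 0).property, _, _,
        cyclesMap_sub_of_homotopy ((isHProj k H).ι.mapHomotopy h)⟩)

/-- The functor `Z⁰ : Tate_H(kG) ⥤ StMod_H(kG)`. -/
noncomputable def tateZ0 : Tate k H ⥤ StMod k H := (isTate k H).ι ⋙ cyclesZero k H

/-- The endofunctor `M ↦ Coind (Res M)` of `Mod(kG)`. As `G` is finite, `Coind (Res M)` is isomorphic
to `Ind (Res M)`, and in particular it is `H`-projective. -/
noncomputable def coindRes : Rep.{u} k G ⥤ Rep.{u} k G :=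
  resH k H ⋙ Rep.coindFunctor k H.subtype

/-- The canonical embedding `M ⟶ Coind (Res M)`, which is the unit of the adjunction between
restriction and coinduction. It is a monomorphism that splits over `H`. -/
noncomputable def embed : 𝟭 (Rep.{u} k G) ⟶ coindRes k H :=
  (Rep.resCoindAdjunction.{u} k H.subtype).unit

instance : (Rep.coindFunctor.{u} k H.subtype).Additive :=
  (Rep.resCoindAdjunction.{u} k H.subtype).right_adjoint_additive

instance : (coindRes k H).Additive :=
  inferInstanceAs (resH k H ⋙ Rep.coindFunctor k H.subtype).Additive

/-- The relative cosyzygy `M ↦ Coker (M ⟶ Coind (Res M))`. -/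
noncomputable def cosyzygy : Rep.{u} k G ⥤ Rep.{u} k G where
  obj M := cokernel ((embed k H).app M)
  map f := cokernel.map _ _ f ((coindRes k H).map f) ((embed k H).naturality f).symm
  map_id M := (cancel_epi (cokernel.π _)).1 (by simp)
  map_comp f g := (cancel_epi (cokernel.π _)).1 (by simp)

/-- The canonical projection `Coind (Res M) ⟶ cosyzygy M`. -/
noncomputable def toCosyzygy : coindRes k H ⟶ cosyzygy k H where
  app M := cokernel.π ((embed k H).app M)
  naturality M _ _ := (cokernel.π_desc ((embed k H).app M) _ _).symm

instance (M : Rep.{u} k G) : Epi ((toCosyzygy k H).app M) :=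
  inferInstanceAs (Epi (cokernel.π ((embed k H).app M)))

instance : (cosyzygy k H).Additive where
  map_add {X Y f g} := by
    rw [← cancel_epi ((toCosyzygy k H).app X), Preadditive.comp_add, ← NatTrans.naturality,
      ← NatTrans.naturality, ← NatTrans.naturality, Functor.map_add, Preadditive.add_comp]

variable [Finite G]

theorem isHProj_coind (N : Rep.{u} k H) : isHProj k H ((Rep.coindFunctor k H.subtype).obj N) := by
  classical
  exact ⟨N, ⟨Retract.ofIso (Rep.indCoindIso N).symm⟩⟩

theorem isHProj_cosyzygy {P : Rep.{u} k G} (hP : isHProj k H P) :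
    isHProj k H ((cosyzygy k H).obj P) := by
  classical
  obtain ⟨N, ⟨r⟩⟩ := hP
  let adj := Rep.resCoindAdjunction.{u} k H.subtype
  let r' : Retract P ((Rep.coindFunctor k H.subtype).obj N) :=
    r.trans (Retract.ofIso (Rep.indCoindIso N))
  let s : (coindRes k H).obj P ⟶ P :=
    (coindRes k H).map r'.i ≫ (Rep.coindFunctor k H.subtype).map (adj.counit.app N) ≫ r'.r
  have hs : (embed k H).app P ≫ s = 𝟙 P := by
    have h1 := (embed k H).naturality r'.i
    have h2 := adj.right_triangle_components N
    simp only [s]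
    rw [← reassoc_of% h1]
    erw [reassoc_of% h2]
    exact r'.retract
  refine (isHProj k H).prop_of_retract (Y := (coindRes k H).obj P)
    ⟨cokernel.desc _ (𝟙 _ - s ≫ (embed k H).app P) ?_, cokernel.π _, ?_⟩ (isHProj_coind k H _)
  · simp [reassoc_of% hs]
  · exact (cancel_epi (cokernel.π ((embed k H).app P))).1 (by simp [cosyzygy])

/-- The suspension functor of `StMod_H(kG)`, induced by the relative cosyzygy. -/
noncomputable def suspension : StMod k H ⥤ StMod k H :=
  CategoryTheory.Quotient.lift _ (cosyzygy k H ⋙ toStMod k H) (by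
    rintro X Y f g ⟨P, hP, a, b, h⟩
    refine CategoryTheory.Quotient.sound _
      ⟨_, isHProj_cosyzygy k H hP, (cosyzygy k H).map a, (cosyzygy k H).map b, ?_⟩
    rw [← Functor.map_comp, h, Functor.map_sub])

/-- The distinguished triangles of `StMod_H(kG)`. A short exact sequence
`0 ⟶ A ⟶ B ⟶ C ⟶ 0` of `kG`-modules which splits over `H` fits into a commutative diagram
```
0 ⟶ A ⟶       B        ⟶     C     ⟶ 0
    ‖         | v            | w
0 ⟶ A ⟶ Coind (Res A) ⟶ cosyzygy A ⟶ 0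
```
and gives a standard triangle `A ⟶ B ⟶ C ⟶ Σ A` whose third map is the class of `w`.
The distinguished triangles are those which are isomorphic to standard ones. The isomorphism `e`
identifies the shift by `1` with the suspension functor. -/
def relDistTriangles [HasShift (StMod k H) ℤ]
    (e : shiftFunctor (StMod k H) (1 : ℤ) ≅ suspension k H) : Set (Triangle (StMod k H)) :=
  {T | ∃ (S : ShortComplex (Rep.{u} k G)) (_ : S.ShortExact)
      (_ : Nonempty (S.map (resH k H)).Splitting)
      (v : S.X₂ ⟶ (coindRes k H).obj S.X₁) (w : S.X₃ ⟶ (cosyzygy k H).obj S.X₁),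
      S.f ≫ v = (embed k H).app S.X₁ ∧ S.g ≫ w = v ≫ (toCosyzygy k H).app S.X₁ ∧
      Nonempty (T ≅ Triangle.mk ((toStMod k H).map S.f) ((toStMod k H).map S.g)
        ((toStMod k H).map w ≫ e.inv.app ((toStMod k H).obj S.X₁)))}

end

end RelStable

namespace RelStable

/-! The short exact sequences of `kG`-modules that split over `H` form a Frobenius structure whose
projective-injective objects are the `H`-projectives: by Frobenius reciprocity `Ind N` is projective
and `Coind N` injective relative to them, the two agree as `G` is finite, and there are enough of
both (`isFrobeniusPair`). A complex of `H`-projectives lies in `Tate_H(kG)` exactly when it is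
spliced from such sequences `Zⁿ ⟶ Xⁿ ⟶ Zⁿ⁺¹`, so it is a complete relative resolution of `Z⁰`.

The equivalence is then the usual argument on complete resolutions. A map on `Z⁰` extends in both
directions to a chain map (`exists_cyclesMap_eq`), a chain map which factors through an
`H`-projective on `Z⁰` is null-homotopic (`nonempty_homotopy_zero`), and every module is spliced
into a complex (`exists_complex_iso_cycles`).

The axioms of a triangulated category are not checked by hand on `StMod_H(kG)`: the structure is
transported along `Z⁰` and then shown to be the standard one. For the suspension, `Z⁰(K) ⟶ K⁰ ⟶
Z⁰(K⟦1⟧)` has an `H`-projective middle term, so its connecting map is a stable isomorphism onto the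
cosyzygy. For the triangles, those of `K(H-Proj)` come from degreewise split sequences, which `Z⁰`
turns into `H`-split sequences with the matching connecting map; hence transported triangles are
standard. Conversely, a standard triangle is determined up to isomorphism by its first map
(`relTriangle_distinguished_of_iso`), so it is isomorphic to a transported one. -/

/-- A relation between consecutive terms of a family indexed by the integers, which can be solved
in both directions, has a solution with a prescribed term. -/
theorem exists_int_family {T : ℤ → Type*} (R : ∀ n m : ℤ, n + 1 = m → T n → T m → Prop)
    (up : ∀ n m h a, ∃ b, R n m h a b) (down : ∀ n m h b, ∃ a, R n m h a b)
    (n₀ : ℤ) (x₀ : T n₀) :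
    ∃ x : ∀ n, T n, x n₀ = x₀ ∧ ∀ n m h, R n m h (x n) (x m) := by
  choose U hU using up
  choose D hD using down
  let x : ∀ n, T n := fun n => Int.inductionOn' n n₀ x₀ (fun n _ a => U n (n + 1) rfl a)
    (fun n _ b => D (n - 1) n (by omega) b)
  refine ⟨x, Int.inductionOn'_self, ?_⟩
  intro n m h
  by_cases hn : n₀ ≤ n
  · obtain rfl := h
    have : x (n + 1) = U n (n + 1) rfl (x n) := Int.inductionOn'_add_one hn
    rw [this]
    exact hU _ _ _ _
  · obtain rfl : n = m - 1 := by omega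
    have : x (m - 1) = D (m - 1) m (by omega) (x m) :=
      Int.inductionOn'_sub_one (by omega)
    rw [this]
    exact hD _ _ _ _

/-! ### Frobenius pairs and complete resolutions -/

section

variable {C : Type*} [Category C] [Abelian C]

/-- Two morphisms of short complexes with the same first component have third components which
differ by a map that lifts to the middle term. -/
theorem exists_lift_sub_τ₃ {S S' : ShortComplex C} (hS : S.ShortExact) (φ ψ : S ⟶ S')
    (h : φ.τ₁ = ψ.τ₁) : ∃ t : S.X₃ ⟶ S'.X₂, t ≫ S'.g = φ.τ₃ - ψ.τ₃ := by
  have := hS.epi_g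
  have h0 : S.f ≫ (φ.τ₂ - ψ.τ₂) = 0 := by
    rw [Preadditive.comp_sub, ← φ.comm₁₂, ← ψ.comm₁₂, h, sub_self]
  refine ⟨hS.exact.desc _ h0, ?_⟩
  rw [← cancel_epi S.g, hS.exact.g_desc_assoc, Preadditive.sub_comp, φ.comm₂₃, ψ.comm₂₃,
    Preadditive.comp_sub]

/-- The short complex `Zⁿ ⟶ Kⁿ ⟶ Zⁿ⁺¹` of a cochain complex. -/
noncomputable abbrev cyclesSeq (K : CochainComplex C ℤ) (n : ℤ) : ShortComplex C :=
  ShortComplex.mk (K.iCycles n) (K.toCycles n (n + 1))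
    (by rw [← cancel_mono (K.iCycles (n + 1))]; simp)

/-- A cochain complex which is spliced from short exact sequences has these as its sequences
of cycles. -/
theorem nonempty_iso_cyclesSeq (K : CochainComplex C ℤ) (A : ℤ → C) (f : ∀ n, A n ⟶ K.X n)
    (g : ∀ n, K.X n ⟶ A (n + 1)) (w : ∀ n, f n ≫ g n = 0)
    (hS : ∀ n, (ShortComplex.mk (f n) (g n) (w n)).ShortExact)
    (hd : ∀ n, K.d n (n + 1) = g n ≫ f (n + 1)) (n : ℤ) :
    Nonempty (ShortComplex.mk (f n) (g n) (w n) ≅ cyclesSeq K n) := by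
  have hm (n : ℤ) : Mono (f n) := (hS n).mono_f
  have key (n : ℤ) : ∃ e : A n ≅ K.cycles n, e.hom ≫ K.iCycles n = f n := by
    let l : IsLimit (KernelFork.ofι (f n) (show f n ≫ K.d n (n + 1) = 0 by
        rw [hd, reassoc_of% w n, zero_comp])) :=
      KernelFork.IsLimit.ofι' _ _ fun a ha =>
        ⟨(hS n).exact.lift a ((cancel_mono (f (n + 1))).1 (by
          simpa [hd] using ha)), (hS n).exact.lift_f _ _⟩
    exact ⟨IsLimit.conePointUniqueUpToIso l (K.cyclesIsKernel n (n + 1) (by simp)),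
      IsLimit.conePointUniqueUpToIso_hom_comp l _ WalkingParallelPair.zero⟩
  choose e he using key
  refine ⟨ShortComplex.isoMk (e n) (Iso.refl _) (e (n + 1)) ?_ ?_⟩
  · simp [he]
  · rw [← cancel_mono (K.iCycles (n + 1))]
    simp [he, hd]

/-- The objects `P` are injective and projective relative to the short exact sequences `E`. -/
structure IsFrobeniusPair (E : ObjectProperty (ShortComplex C)) (P : ObjectProperty C) :
    Prop where
  shortExact {S : ShortComplex C} (hS : E S) : S.ShortExact
  injective {S : ShortComplex C} (hS : E S) {Q : C} (hQ : P Q) (f : S.X₁ ⟶ Q) :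
    ∃ g : S.X₂ ⟶ Q, S.f ≫ g = f
  projective {S : ShortComplex C} (hS : E S) {Q : C} (hQ : P Q) (f : Q ⟶ S.X₃) :
    ∃ g : Q ⟶ S.X₂, g ≫ S.g = f

namespace IsFrobeniusPair

variable {E : ObjectProperty (ShortComplex C)} {P : ObjectProperty C} (h : IsFrobeniusPair E P)

include h

theorem injective_cycles {K : CochainComplex C ℤ} {n : ℤ} (hK : E (cyclesSeq K n)) {Q : C}
    (hQ : P Q) (f : K.cycles n ⟶ Q) : ∃ g : K.X n ⟶ Q, K.iCycles n ≫ g = f :=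
  h.injective hK hQ f

/-- The equation `n + 1 = m` is a hypothesis so that the target degree may be a variable; the
recursions below need this. -/
theorem projective_cycles {K : CochainComplex C ℤ} {n m : ℤ} (hnm : n + 1 = m)
    (hK : E (cyclesSeq K n)) {Q : C}
    (hQ : P Q) (f : Q ⟶ K.cycles m) : ∃ g : Q ⟶ K.X n, g ≫ K.toCycles n m = f := by
  subst hnm
  exact h.projective hK hQ f

theorem desc_cycles {K : CochainComplex C ℤ} {n m : ℤ} (hnm : n + 1 = m)
    (hK : E (cyclesSeq K n)) {Q : C}
    (f : K.X n ⟶ Q) (hf : K.iCycles n ≫ f = 0) : ∃ g : K.cycles m ⟶ Q,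
      K.toCycles n m ≫ g = f := by
  subst hnm
  have := (h.shortExact hK).epi_g
  exact ⟨(h.shortExact hK).exact.desc f hf, (h.shortExact hK).exact.g_desc _ _⟩

theorem epi_toCycles {K : CochainComplex C ℤ} {n m : ℤ} (hnm : n + 1 = m)
    (hK : E (cyclesSeq K n)) : Epi (K.toCycles n m) := by
  subst hnm
  exact (h.shortExact hK).epi_g

variable {X Y : CochainComplex C ℤ} (hX : ∀ n, E (cyclesSeq X n)) (hY : ∀ n, E (cyclesSeq Y n))
  (hPX : ∀ n, P (X.X n)) (hPY : ∀ n, P (Y.X n))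

include hX hY hPX hPY

/-- Maps between cocycles extend to chain maps. -/
theorem exists_cyclesMap_eq (n₀ : ℤ) (φ : X.cycles n₀ ⟶ Y.cycles n₀) :
    ∃ f : X ⟶ Y, HomologicalComplex.cyclesMap f n₀ = φ := by
  -- The recursion runs over the maps on cocycles; the components of the chain map only appear
  -- existentially, as maps of short exact sequences. Upwards one extends into `Yⁿ` and passes to
  -- the quotients, downwards one lifts from `Xⁿ` and restricts to the kernels.
  obtain ⟨c, hc₀, hc⟩ := exists_int_family (T := fun n => X.cycles n ⟶ Y.cycles n)
    (fun n m _ a b => ∃ f : X.X n ⟶ Y.X n, X.iCycles n ≫ f = a ≫ Y.iCycles n ∧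
      f ≫ Y.toCycles n m = X.toCycles n m ≫ b)
    (by
      intro n m hnm a
      obtain ⟨f, hf⟩ := h.injective_cycles (hX n) (hPY n) (a ≫ Y.iCycles n)
      obtain ⟨b, hb⟩ := h.desc_cycles hnm (hX n) (f ≫ Y.toCycles n m) (by
        rw [reassoc_of% hf, ← cancel_mono (Y.iCycles m)]
        simp)
      exact ⟨b, f, hf, hb.symm⟩)
    (by
      intro n m hnm b
      obtain ⟨f, hf⟩ := h.projective_cycles hnm (hY n) (hPX n) (X.toCycles n m ≫ b)
      have h0 : (X.iCycles n ≫ f) ≫ Y.d n m = 0 := by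
        rw [← Y.toCycles_i, Category.assoc, reassoc_of% hf]
        have : X.iCycles n ≫ X.toCycles n m = 0 := by
          rw [← cancel_mono (X.iCycles m)]; simp
        rw [reassoc_of% this, zero_comp]
      exact ⟨Y.liftCycles (X.iCycles n ≫ f) m (by simp [hnm]) h0, f, by simp, hf⟩)
    n₀ φ
  have hc' (n : ℤ) := hc n (n + 1) rfl
  choose f hf₁ hf₂ using hc'
  refine ⟨{ f := f, comm' := ?_ }, ?_⟩
  · intro i j hij
    obtain rfl : i + 1 = j := hij
    rw [← Y.toCycles_i, reassoc_of% hf₂ i, ← hf₁, HomologicalComplex.toCycles_i_assoc]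
  · rw [← cancel_mono (Y.iCycles n₀), ← hc₀, ← hf₁]
    simp

/-- A chain map is null-homotopic if it factors through an object of `P` on cocycles. -/
theorem nonempty_homotopy_zero (f : X ⟶ Y) (n₀ : ℤ) {Q : C} (hQ : P Q) (a : X.cycles n₀ ⟶ Q)
    (b : Q ⟶ Y.cycles n₀) (hab : a ≫ b = HomologicalComplex.cyclesMap f n₀) :
    Nonempty (Homotopy f 0) := by
  obtain ⟨m₀, rfl⟩ : ∃ m, n₀ = m + 1 := ⟨n₀ - 1, by omega⟩
  obtain ⟨a', ha'⟩ := h.injective_cycles (hX (m₀ + 1)) hQ a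
  obtain ⟨b', hb'⟩ := h.projective_cycles rfl (hY m₀) hQ b
  -- The condition on `s` keeps the recursion going: it makes `f - s d` vanish on cocycles, hence
  -- extend from `Zⁿ⁺²(X)` to the next component. Downwards, it makes `f - d t` take values in
  -- cocycles, hence lift to `Yⁿ`. The start is `a' ≫ b'`, which extends `a` and lifts `b`.
  obtain ⟨c, -, hc⟩ := exists_int_family
    (T := fun n => { s : X.X (n + 1) ⟶ Y.X n // X.iCycles (n + 1) ≫ s ≫ Y.toCycles n (n + 1) =
      HomologicalComplex.cyclesMap f (n + 1) })
    (fun n m hnm s t => f.f (n + 1) = s.1 ≫ Y.d n (n + 1) + X.d (n + 1) (m + 1) ≫ t.1 ≫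
      (Y.XIsoOfEq hnm.symm).hom)
    (by
      rintro n m rfl ⟨s, hs⟩
      obtain ⟨t, ht⟩ := h.desc_cycles rfl (hX (n + 1)) (f.f (n + 1) - s ≫ Y.d n (n + 1)) (by
        have := hs =≫ Y.iCycles (n + 1)
        rw [HomologicalComplex.cyclesMap_i] at this
        simp [← this])
      obtain ⟨s', hs'⟩ := h.injective_cycles (hX (n + 1 + 1)) (hPY (n + 1)) t
      refine ⟨⟨s', ?_⟩, ?_⟩
      · have := h.epi_toCycles rfl (hX (n + 1))
        rw [← cancel_epi (X.toCycles (n + 1) (n + 1 + 1)), ← cancel_mono (Y.iCycles _),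
          reassoc_of% hs', reassoc_of% ht]
        simp
      · have hd : X.d (n + 1) (n + 1 + 1) ≫ s' = f.f (n + 1) - s ≫ Y.d n (n + 1) := by
          rw [← X.toCycles_i, Category.assoc, hs', ht]
        simp [hd])
    (by
      rintro n m rfl ⟨t, ht⟩
      have h0 : X.toCycles (n + 1) (n + 1 + 1) ≫ X.iCycles (n + 1 + 1) ≫ t ≫
          Y.toCycles (n + 1) (n + 1 + 1) ≫ Y.iCycles _ = f.f (n + 1) ≫ Y.d _ _ := by
        rw [reassoc_of% ht]
        simp
      have h1 : (f.f (n + 1) - X.d (n + 1) (n + 1 + 1) ≫ t) ≫ Y.d (n + 1) (n + 1 + 1) = 0 := by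
        rw [Preadditive.sub_comp, ← h0]
        simp
      obtain ⟨s, hs⟩ := h.projective_cycles rfl (hY n) (hPX (n + 1))
        (Y.liftCycles _ (n + 1 + 1) (by simp) h1)
      have hs' := hs =≫ Y.iCycles (n + 1)
      rw [Category.assoc, Y.toCycles_i, Y.liftCycles_i] at hs'
      refine ⟨⟨s, ?_⟩, ?_⟩
      · rw [← cancel_mono (Y.iCycles _), Category.assoc, Category.assoc, Y.toCycles_i, hs']
        simp
      · rw [hs']
        simp)
    m₀ ⟨a' ≫ b', by rw [Category.assoc, hb', reassoc_of% ha', hab]⟩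
  refine ⟨⟨fun i j => if hij : j + 1 = i then (X.XIsoOfEq hij.symm).hom ≫ (c j).1 else 0,
    fun i j hij => dif_neg hij, fun i => ?_⟩⟩
  obtain ⟨n, rfl⟩ : ∃ n, i = n + 1 := ⟨i - 1, by omega⟩
  rw [dNext_eq _ (show (ComplexShape.up ℤ).Rel (n + 1) (n + 1 + 1) from rfl),
      prevD_eq _ (show (ComplexShape.up ℤ).Rel n (n + 1) from rfl), hc n (n + 1) rfl]
  simp [add_comm]

end IsFrobeniusPair

/-- If there are enough objects of `P`, then any object is the cocycles of a complex of such. -/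
theorem exists_complex_iso_cycles {E : ObjectProperty (ShortComplex C)}
    [E.IsClosedUnderIsomorphisms] {P : ObjectProperty C} (h : IsFrobeniusPair E P)
    (enoughInj : ∀ A : C, ∃ (Q B : C) (f : A ⟶ Q) (g : Q ⟶ B) (w : f ≫ g = 0), P Q ∧
      E (ShortComplex.mk f g w))
    (enoughProj : ∀ B : C, ∃ (A Q : C) (f : A ⟶ Q) (g : Q ⟶ B) (w : f ≫ g = 0), P Q ∧
      E (ShortComplex.mk f g w)) (n₀ : ℤ) (M : C) :
    ∃ X : CochainComplex C ℤ, (∀ n, P (X.X n)) ∧ (∀ n, E (cyclesSeq X n)) ∧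
      Nonempty (X.cycles n₀ ≅ M) := by
  -- The recursion produces the future cocycles `A n`; the terms of the complex are the middle
  -- objects `Q n`.
  obtain ⟨A, hA₀, hA⟩ := exists_int_family (T := fun _ => C)
    (fun n m _ A B => ∃ (Q : C) (f : A ⟶ Q) (g : Q ⟶ B) (w : f ≫ g = 0), P Q ∧
      E (ShortComplex.mk f g w))
    (fun n m _ A => by
      obtain ⟨Q, B, f, g, w, hQ⟩ := enoughInj A
      exact ⟨B, Q, f, g, w, hQ⟩)
    (fun n m _ B => by
      obtain ⟨A, Q, f, g, w, hQ⟩ := enoughProj B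
      exact ⟨A, Q, f, g, w, hQ⟩) n₀ M
  have hA' (n : ℤ) := hA n (n + 1) rfl
  choose Q f g w hQ hE using hA'
  let X : CochainComplex C ℤ := CochainComplex.of Q (fun n => g n ≫ f (n + 1))
    (fun n => by simp [reassoc_of% w (n + 1)])
  have key := nonempty_iso_cyclesSeq X A f g w (fun n => h.shortExact (hE n))
    (fun n => CochainComplex.of_d Q (fun n => g n ≫ f (n + 1)) n)
  refine ⟨X, hQ, fun n => ?_, ?_⟩
  · obtain ⟨e⟩ := key n
    exact E.prop_of_iso e (hE n)
  · obtain ⟨e⟩ := key n₀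
    exact ⟨(ShortComplex.π₁.mapIso e).symm ≪≫ eqToIso hA₀⟩

end

/-! ### Exactness in terms of cocycles -/

section

variable {C : Type*} [Category C] [Abelian C]

theorem sc'_exact_iff_epi_toCycles (K : CochainComplex C ℤ) (n : ℤ) :
    (K.sc' n (n + 1) (n + 1 + 1)).Exact ↔ Epi (K.toCycles n (n + 1)) := by
  rw [ShortComplex.exact_iff_epi_toCycles,
    ← K.toCycles_cyclesIsoSc'_hom n (n + 1) (n + 1 + 1) (by simp) (by simp)]
  exact (epi_comp_iff_of_isIso (K.toCycles n (n + 1))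
    (K.cyclesIsoSc' n (n + 1) (n + 1 + 1) _ _).hom)

theorem cyclesSeq_shortExact (K : CochainComplex C ℤ) (n : ℤ) [Epi (K.toCycles n (n + 1))] :
    (cyclesSeq K n).ShortExact where
  exact := ShortComplex.exact_of_f_is_kernel _ (KernelFork.IsLimit.ofι' _ _ fun a ha =>
    ⟨K.liftCycles a (n + 1) (by simp) (by
      rw [← K.toCycles_i]
      exact (reassoc_of% ha) _ |>.trans zero_comp), K.liftCycles_i _ _ _ _⟩)
  mono_f := inferInstanceAs (Mono (K.iCycles n))
  epi_g := ‹_›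

end

/-! ### The sequences that split over `H` -/

section

variable (k : Type u) [CommRing k] {G : Type u} [Group G] (H : Subgroup G)

/-- The short exact sequences of `kG`-modules which split over `H`. -/
def relSplit : ObjectProperty (ShortComplex (Rep.{u} k G)) := fun S =>
  S.ShortExact ∧ Nonempty (S.map (resH k H)).Splitting

instance : (relSplit k H).IsClosedUnderIsomorphisms where
  of_iso e := fun ⟨h, ⟨s⟩⟩ =>
    ⟨ShortComplex.shortExact_of_iso e h, ⟨s.ofIso ((resH k H).mapShortComplex.mapIso e)⟩⟩

/-- Restriction has induction as left and coinduction as right adjoint, so it is exact. -/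
instance : PreservesFiniteLimits (resH k H) :=
  have := (Rep.indResAdjunction.{u} k H.subtype).rightAdjoint_preservesLimits
  inferInstance

instance : PreservesFiniteColimits (resH k H) :=
  have := (Rep.resCoindAdjunction.{u} k H.subtype).leftAdjoint_preservesColimits
  inferInstance

instance : (resH k H).PreservesEpimorphisms :=
  Functor.preservesEpimorphisms_of_adjunction (Rep.resCoindAdjunction.{u} k H.subtype)

instance : (resH k H).PreservesMonomorphisms :=
  Functor.preservesMonomorphisms_of_adjunction (Rep.indResAdjunction.{u} k H.subtype)

variable {k H} in
theorem relSplit.exists_retraction {S : ShortComplex (Rep.{u} k G)} (hS : relSplit k H S) :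
    ∃ r : (resH k H).obj S.X₂ ⟶ (resH k H).obj S.X₁, (resH k H).map S.f ≫ r = 𝟙 _ := by
  obtain ⟨-, ⟨s⟩⟩ := hS
  exact ⟨s.r, s.f_r⟩

variable {k H} in
theorem relSplit.exists_section {S : ShortComplex (Rep.{u} k G)} (hS : relSplit k H S) :
    ∃ s : (resH k H).obj S.X₃ ⟶ (resH k H).obj S.X₂, s ≫ (resH k H).map S.g = 𝟙 _ := by
  obtain ⟨-, ⟨s⟩⟩ := hS
  exact ⟨s.s, s.s_g⟩

theorem relSplit_of_retraction {S : ShortComplex (Rep.{u} k G)} (hS : S.ShortExact)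
    (r : (resH k H).obj S.X₂ ⟶ (resH k H).obj S.X₁) (hr : (resH k H).map S.f ≫ r = 𝟙 _) :
    relSplit k H S := by
  have h := hS.map_of_exact (resH k H)
  exact ⟨hS, ⟨ShortComplex.Splitting.ofExactOfRetraction _ h.exact r hr h.epi_g⟩⟩

theorem relSplit_of_section {S : ShortComplex (Rep.{u} k G)} (hS : S.ShortExact)
    (s : (resH k H).obj S.X₃ ⟶ (resH k H).obj S.X₂) (hs : s ≫ (resH k H).map S.g = 𝟙 _) :
    relSplit k H S := by
  have h := hS.map_of_exact (resH k H)
  exact ⟨hS, ⟨ShortComplex.Splitting.ofExactOfSection _ h.exact s hs h.mono_f⟩⟩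

theorem res_embed_counit (M : Rep.{u} k G) : (resH k H).map ((embed k H).app M) ≫
    (Rep.resCoindAdjunction.{u} k H.subtype).counit.app ((resH k H).obj M) = 𝟙 _ :=
  (Rep.resCoindAdjunction.{u} k H.subtype).left_triangle_components M

instance (M : Rep.{u} k G) : Mono ((embed k H).app M) := by
  have : Mono ((resH k H).map ((embed k H).app M)) := mono_of_mono_fac (res_embed_counit k H M)
  exact (resH k H).mono_of_mono_map this

theorem embed_comp_toCosyzygy (M : Rep.{u} k G) :
    (embed k H).app M ≫ (toCosyzygy k H).app M = 0 :=
  cokernel.condition _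

/-- The canonical sequence `M ⟶ Coind (Res M) ⟶ cosyzygy M`. -/
noncomputable abbrev cosyzygySeq (M : Rep.{u} k G) : ShortComplex (Rep.{u} k G) :=
  ShortComplex.mk _ _ (embed_comp_toCosyzygy k H M)

theorem relSplit_cosyzygySeq (M : Rep.{u} k G) : relSplit k H (cosyzygySeq k H M) :=
  relSplit_of_retraction k H
    { exact := ShortComplex.exact_of_g_is_cokernel _ (cokernelIsCokernel ((embed k H).app M)) }
    _ (res_embed_counit k H M)

/-- The counit `Ind (Res M) ⟶ M` is split over `H` by the unit, by a triangle identity. -/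
theorem exists_relSplit_of_right (M : Rep.{u} k G) :
    ∃ (A Q : Rep.{u} k G) (f : A ⟶ Q) (g : Q ⟶ M) (w : f ≫ g = 0), isHProj k H Q ∧
      relSplit k H (ShortComplex.mk f g w) := by
  let adj := Rep.indResAdjunction.{u} k H.subtype
  have h1 : adj.unit.app ((resH k H).obj M) ≫ (resH k H).map (adj.counit.app M) = 𝟙 _ :=
    adj.right_triangle_components M
  have : Epi ((resH k H).map (adj.counit.app M)) := epi_of_epi_fac h1
  have : Epi (adj.counit.app M) := (resH k H).epi_of_epi_map this
  exact ⟨_, _, kernel.ι (adj.counit.app M), adj.counit.app M, kernel.condition _,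
    ⟨_, ⟨Retract.refl _⟩⟩, relSplit_of_section k H
    { exact := ShortComplex.exact_of_f_is_kernel _ (kernelIsKernel (adj.counit.app M))
      mono_f := inferInstanceAs (Mono (kernel.ι (adj.counit.app M))) } _ h1⟩

/-- Exactness descends because restriction is exact and faithful. If `d s d = d` for the
differential entering degree `n`, then `s` followed by that differential retracts the `n`-th term
onto `Zⁿ` over `H`. -/
theorem relSplit_cyclesSeq_of_isSplitExact {K : CochainComplex (Rep.{u} k G) ℤ}
    (hK : IsSplitExact (((resH k H).mapHomologicalComplex (ComplexShape.up ℤ)).obj K)) (n : ℤ) :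
    relSplit k H (cyclesSeq K n) := by
  have hepi (i : ℤ) : Epi (K.toCycles i (i + 1)) := by
    have h1 := hK.1 (i + 1)
    rw [HomologicalComplex.exactAt_iff' _ i (i + 1) (i + 1 + 1) (by simp) (by simp)] at h1
    have h2 : (K.sc' i (i + 1) (i + 1 + 1)).Exact :=
      (ShortComplex.exact_map_iff_of_faithful _ (resH k H)).1 h1
    exact (sc'_exact_iff_epi_toCycles K i).1 h2
  obtain ⟨m, rfl⟩ : ∃ m, n = m + 1 := ⟨n - 1, by omega⟩
  obtain ⟨s, hs⟩ : ∃ s : (resH k H).obj (K.X (m + 1)) ⟶ (resH k H).obj (K.X m),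
      (resH k H).map (K.d m (m + 1)) ≫ s ≫ (resH k H).map (K.d m (m + 1)) =
        (resH k H).map (K.d m (m + 1)) := hK.2 m (m + 1)
  refine relSplit_of_retraction k H (cyclesSeq_shortExact K _) (s ≫ (resH k H).map (K.toCycles m (m + 1))) ?_
  change (resH k H).map (K.iCycles (m + 1)) ≫ s ≫ (resH k H).map (K.toCycles m (m + 1)) = 𝟙 _
  have := hepi m
  have : Epi ((resH k H).map (K.toCycles m (m + 1))) := (resH k H).map_epi _
  have : Mono ((resH k H).map (K.iCycles (m + 1))) := (resH k H).map_mono _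
  rw [← cancel_epi ((resH k H).map (K.toCycles m (m + 1))),
    ← cancel_mono ((resH k H).map (K.iCycles (m + 1)))]
  rw [← K.toCycles_i, Functor.map_comp, Category.assoc] at hs
  rw [Category.comp_id, Category.assoc, Category.assoc]
  exact hs

/-- A retraction onto `Zⁱ⁺¹` followed by a section of `Kⁱ ⟶ Zⁱ⁺¹` splits the differential. -/
theorem isSplitExact_of_relSplit_cyclesSeq {K : CochainComplex (Rep.{u} k G) ℤ}
    (hK : ∀ n, relSplit k H (cyclesSeq K n)) :
    IsSplitExact (((resH k H).mapHomologicalComplex (ComplexShape.up ℤ)).obj K) := by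
  refine ⟨fun n => ?_, fun i j => ?_⟩
  · obtain ⟨m, rfl⟩ : ∃ m, n = m + 1 := ⟨n - 1, by omega⟩
    rw [HomologicalComplex.exactAt_iff' _ m (m + 1) (m + 1 + 1) (by simp) (by simp)]
    have h2 : (K.sc' m (m + 1) (m + 1 + 1)).Exact :=
      (sc'_exact_iff_epi_toCycles K m).2 (hK m).1.epi_g
    exact h2.map (resH k H)
  · by_cases hij : i + 1 = j
    · subst hij
      obtain ⟨s, hs⟩ : ∃ s : (resH k H).obj (K.cycles (i + 1)) ⟶ (resH k H).obj (K.X i),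
        s ≫ (resH k H).map (K.toCycles i (i + 1)) = 𝟙 _ := (hK i).exists_section
      obtain ⟨r, hr⟩ : ∃ r : (resH k H).obj (K.X (i + 1)) ⟶ (resH k H).obj (K.cycles (i + 1)),
        (resH k H).map (K.iCycles (i + 1)) ≫ r = 𝟙 _ := (hK (i + 1)).exists_retraction
      refine ⟨r ≫ s, ?_⟩
      change (resH k H).map (K.d i (i + 1)) ≫ (r ≫ s) ≫ (resH k H).map (K.d i (i + 1)) =
        (resH k H).map (K.d i (i + 1))
      rw [← K.toCycles_i, Functor.map_comp, Category.assoc, Category.assoc, reassoc_of% hr,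
        reassoc_of% hs]
    · exact ⟨0, by
        rw [HomologicalComplex.shape _ _ _ hij, zero_comp]⟩

variable [Finite G]

theorem exists_relSplit_of_left (M : Rep.{u} k G) :
    ∃ (Q B : Rep.{u} k G) (f : M ⟶ Q) (g : Q ⟶ B) (w : f ≫ g = 0), isHProj k H Q ∧
      relSplit k H (ShortComplex.mk f g w) :=
  ⟨_, _, _, _, _, isHProj_coind k H _, relSplit_cosyzygySeq k H M⟩

/-- By adjunction, extending a map into `Coind N` or lifting a map out of `Ind N` is a problem over
`H`, where the splitting solves it. Both properties pass to retracts, and `Ind N ≅ Coind N` lets one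
class have both. -/
theorem isFrobeniusPair : IsFrobeniusPair (relSplit k H) (isHProj k H) where
  shortExact hS := hS.1
  injective := by
    classical
    rintro S hS Q ⟨N, ⟨r⟩⟩ f
    obtain ⟨s, hs⟩ := hS.exists_retraction
    let adj := Rep.resCoindAdjunction.{u} k H.subtype
    let r' : Retract Q ((Rep.coindFunctor k H.subtype).obj N) :=
      r.trans (Retract.ofIso (Rep.indCoindIso N))
    refine ⟨adj.homEquiv _ _ (s ≫ (adj.homEquiv _ _).symm (f ≫ r'.i)) ≫ r'.r, ?_⟩
    rw [← Category.assoc, ← adj.homEquiv_naturality_left]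
    rw [reassoc_of% hs]
    simp
  projective := by
    rintro S hS Q ⟨N, ⟨r⟩⟩ f
    obtain ⟨s, hs⟩ := hS.exists_section
    let adj := Rep.indResAdjunction.{u} k H.subtype
    refine ⟨r.i ≫ (adj.homEquiv _ _).symm (adj.homEquiv _ _ (r.r ≫ f) ≫ s), ?_⟩
    rw [Category.assoc, ← adj.homEquiv_naturality_right_symm, Category.assoc]
    rw [hs, Category.comp_id]
    simp

end

/-! ### The functor `Z⁰` is an equivalence -/

section

variable (k : Type u) [CommRing k] {G : Type u} [Group G] (H : Subgroup G)

theorem toStMod_map_eq_iff {X Y : Rep.{u} k G} (f g : X ⟶ Y) :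
    (toStMod k H).map f = (toStMod k H).map g ↔ stableRel k H f g :=
  CategoryTheory.Quotient.functor_map_eq_iff _ _ _

/-- A homotopy between maps of complexes of `H`-projective modules is a homotopy between the
underlying maps of complexes of modules. -/
theorem nonempty_homotopy_of_underlying {X Y : CochainComplex (HProj k H) ℤ} {f g : X ⟶ Y}
    (h : Homotopy ((underlying k H).map f) ((underlying k H).map g)) : Nonempty (Homotopy f g) := by
  refine ⟨⟨fun i j => ObjectProperty.homMk (h.hom i j), fun i j hij => ?_, fun i => ?_⟩⟩
  · ext1
    exact h.zero i j hij
  · obtain ⟨n, rfl⟩ : ∃ n, i = n + 1 := ⟨i - 1, by omega⟩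
    have := h.comm (n + 1)
    rw [dNext_eq _ (show (ComplexShape.up ℤ).Rel (n + 1) (n + 1 + 1) from rfl),
      prevD_eq _ (show (ComplexShape.up ℤ).Rel n (n + 1) from rfl)] at this ⊢
    ext1
    exact this

theorem isTate_quotient_iff (X : CochainComplex (HProj k H) ℤ) :
    isTate k H ((HomotopyCategory.quotient _ _).obj X) ↔
      ∀ n, relSplit k H (cyclesSeq ((underlying k H).obj X) n) :=
  ⟨fun h n => relSplit_cyclesSeq_of_isSplitExact k H h n,
    fun h => isSplitExact_of_relSplit_cyclesSeq k H h⟩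

theorem isHProj_underlying_X (X : CochainComplex (HProj k H) ℤ) (n : ℤ) :
    isHProj k H (((underlying k H).obj X).X n) := (X.X n).property

theorem isTate.relSplit {X : KHProj k H} (h : isTate k H X) (n : ℤ) :
    relSplit k H (cyclesSeq ((underlying k H).obj X.as) n) :=
  relSplit_cyclesSeq_of_isSplitExact k H h n

instance : (HomologicalComplex.cyclesFunctor (Rep.{u} k G) (ComplexShape.up ℤ) 0).Additive where
  map_add := ShortComplex.cyclesMap_add
    ((HomologicalComplex.shortComplexFunctor _ _ 0).map _)
    ((HomologicalComplex.shortComplexFunctor _ _ 0).map _)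

instance : (cyclesZero k H).Additive := by
  have : (HomotopyCategory.quotient (HProj k H) (ComplexShape.up ℤ) ⋙ cyclesZero k H).Additive :=
    inferInstanceAs (underlying k H ⋙
      HomologicalComplex.cyclesFunctor (Rep.{u} k G) (ComplexShape.up ℤ) 0 ⋙ toStMod k H).Additive
  exact Functor.additive_of_full_essSurj_comp (HomotopyCategory.quotient _ _) _

instance : (tateZ0 k H).Additive := inferInstanceAs ((isTate k H).ι ⋙ cyclesZero k H).Additive

variable [Finite G]

instance : (tateZ0 k H).Full where
  map_surjective {X Y} f := by
    obtain ⟨φ, rfl⟩ : ∃ φ : ((underlying k H).obj X.obj.as).cycles 0 ⟶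
        ((underlying k H).obj Y.obj.as).cycles 0, (toStMod k H).map φ = f :=
      (toStMod k H).map_surjective f
    obtain ⟨g, rfl⟩ := (isFrobeniusPair k H).exists_cyclesMap_eq X.property.relSplit
      Y.property.relSplit (isHProj_underlying_X k H _) (isHProj_underlying_X k H _) 0 φ
    obtain ⟨g, rfl⟩ := (underlying k H).map_surjective g
    exact ⟨ObjectProperty.homMk ((HomotopyCategory.quotient _ _).map g), rfl⟩

instance : (tateZ0 k H).Faithful where
  map_injective {X Y} := by
    rintro ⟨f⟩ ⟨g⟩ hfg
    obtain ⟨f, rfl⟩ := (HomotopyCategory.quotient _ _).map_surjective f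
    obtain ⟨g, rfl⟩ := (HomotopyCategory.quotient _ _).map_surjective g
    obtain ⟨P, hP, a, b, hab⟩ := (toStMod_map_eq_iff k H _ _).1 hfg
    congr 1
    -- Stable equality is a factorization of the difference on cocycles through an `H`-projective,
    -- which is the hypothesis for null-homotopy.
    obtain ⟨h⟩ := (isFrobeniusPair k H).nonempty_homotopy_zero X.property.relSplit
      Y.property.relSplit (isHProj_underlying_X k H _) (isHProj_underlying_X k H _)
      ((underlying k H).map f - (underlying k H).map g) 0 hP a b (hab.trans
        ((HomologicalComplex.cyclesFunctor (Rep.{u} k G) (ComplexShape.up ℤ) 0).map_sub).symm)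
    obtain ⟨h'⟩ := nonempty_homotopy_of_underlying k H
      ((Homotopy.equivSubZero).symm h)
    exact HomotopyCategory.eq_of_homotopy _ _ h'

theorem exists_tate_iso (M : Rep.{u} k G) : ∃ X : CochainComplex (HProj k H) ℤ,
    isTate k H ((HomotopyCategory.quotient _ _).obj X) ∧
      Nonempty (((underlying k H).obj X).cycles 0 ≅ M) := by
  obtain ⟨X, hP, hX, e⟩ := exists_complex_iso_cycles (isFrobeniusPair k H)
    (exists_relSplit_of_left k H) (exists_relSplit_of_right k H) 0 M
  exact ⟨{  X := fun n => ⟨X.X n, hP n⟩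
            d := fun i j => ObjectProperty.homMk (X.d i j)
            shape := fun i j hij => by ext1; exact X.shape i j hij
            d_comp_d' := fun i j l _ _ => by ext1; exact X.d_comp_d i j l },
    (isTate_quotient_iff k H _).2 hX, e⟩

instance : (tateZ0 k H).EssSurj where
  mem_essImage M := by
    obtain ⟨X, hX, ⟨e⟩⟩ := exists_tate_iso k H M.as
    exact ⟨⟨_, hX⟩, ⟨(toStMod k H).mapIso e⟩⟩

instance : (tateZ0 k H).IsEquivalence where

end

/-! ### Cocycles of a shifted complex -/

section

variable {C : Type*} [Category C] [Abelian C] {A B : CochainComplex C ℤ}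
  (φ : ∀ n, A.X (n + 1) ≅ B.X n)
  (hφ : ∀ n, (φ n).hom ≫ B.d n (n + 1) = -A.d (n + 1) (n + 1 + 1) ≫ (φ (n + 1)).hom)

include hφ in
theorem shiftXIso_inv_comp_d (n : ℤ) :
    (φ n).inv ≫ A.d (n + 1) (n + 1 + 1) = -B.d n (n + 1) ≫ (φ (n + 1)).inv := by
  rw [Iso.inv_comp_eq, Preadditive.comp_neg, reassoc_of% hφ n]
  simp

/-- The map `Aⁿ ⟶ Zⁿ(B)` given by the differential when `B` is a shift of `A`. -/
noncomputable def toCyclesOfShift (n : ℤ) : A.X n ⟶ B.cycles n :=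
  -- The sign is that of the differential of the shift. It is also the one for which
  -- `cyclesShortComplexToShift` commutes.
  B.liftCycles (-A.d n (n + 1) ≫ (φ n).hom) (n + 1) (by simp) (by simp [hφ])

theorem toCyclesOfShift_i (n : ℤ) :
    toCyclesOfShift φ hφ n ≫ B.iCycles n = -A.d n (n + 1) ≫ (φ n).hom :=
  B.liftCycles_i _ _ _ _

theorem toCyclesOfShift_i_assoc (n : ℤ) {Z : C} (f : B.X n ⟶ Z) :
    toCyclesOfShift φ hφ n ≫ B.iCycles n ≫ f = (-A.d n (n + 1) ≫ (φ n).hom) ≫ f := by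
  rw [← Category.assoc, toCyclesOfShift_i]

/-- The short complex `Zⁿ(A) ⟶ Aⁿ ⟶ Zⁿ(B)` when `B` is a shift of `A`. -/
noncomputable abbrev shiftCyclesSeq (n : ℤ) : ShortComplex C :=
  ShortComplex.mk (A.iCycles n) (toCyclesOfShift φ hφ n) (by
    rw [← cancel_mono (B.iCycles n)]
    simp [toCyclesOfShift_i])

/-- The cocycles of a shift. -/
noncomputable def shiftCyclesIso (n : ℤ) : A.cycles (n + 1) ≅ B.cycles n where
  hom := B.liftCycles (-A.iCycles (n + 1) ≫ (φ n).hom) (n + 1) (by simp) (by simp [hφ])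
  inv := A.liftCycles (-B.iCycles n ≫ (φ n).inv) (n + 1 + 1) (by simp)
    (by simp [shiftXIso_inv_comp_d φ hφ])
  hom_inv_id := by
    rw [← cancel_mono (A.iCycles (n + 1))]
    simp
  inv_hom_id := by
    rw [← cancel_mono (B.iCycles n)]
    simp

/-- The comparison with the sequence of cycles of `A`. -/
noncomputable def cyclesSeqIso (n : ℤ) : cyclesSeq A n ≅ shiftCyclesSeq φ hφ n :=
  ShortComplex.isoMk (Iso.refl _) (Iso.refl _) (shiftCyclesIso φ hφ n)
    (by simp)
    (by
      rw [← cancel_mono (B.iCycles n)]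
      simp [toCyclesOfShift_i, shiftCyclesIso])

end

/-! ### Connecting maps in the stable category -/

section

variable (k : Type u) [CommRing k] {G : Type u} [Group G] (H : Subgroup G) [Finite G]

theorem isHProj_coindRes (M : Rep.{u} k G) : isHProj k H ((coindRes k H).obj M) :=
  isHProj_coind k H _

/-- A connecting map of `S` is the map induced on the third terms by an extension of the
canonical embedding of `S.X₁`. -/
def IsConnecting (S : ShortComplex (Rep.{u} k G)) (w : S.X₃ ⟶ (cosyzygy k H).obj S.X₁) : Prop :=
  ∃ v : S.X₂ ⟶ (coindRes k H).obj S.X₁,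
    S.f ≫ v = (embed k H).app S.X₁ ∧ S.g ≫ w = v ≫ (toCosyzygy k H).app S.X₁

variable {k H}

/-- `Coind (Res S.X₁)` is relatively injective, so the canonical embedding extends along `S.f`. -/
theorem exists_isConnecting {S : ShortComplex (Rep.{u} k G)} (hS : relSplit k H S) :
    ∃ w, IsConnecting k H S w := by
  obtain ⟨v, hv⟩ := (isFrobeniusPair k H).injective hS (isHProj_coindRes k H S.X₁)
    ((embed k H).app S.X₁)
  have := hS.1.epi_g
  have h0 : S.f ≫ v ≫ (toCosyzygy k H).app S.X₁ = 0 := by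
    rw [← embed_comp_toCosyzygy k H S.X₁, ← hv, Category.assoc]
  exact ⟨hS.1.exact.desc _ h0, v, hv, hS.1.exact.g_desc _ h0⟩

/-- Stably, connecting maps are natural. -/
theorem IsConnecting.naturality {S S' : ShortComplex (Rep.{u} k G)} (hS : S.ShortExact)
    (φ : S ⟶ S') {w : S.X₃ ⟶ (cosyzygy k H).obj S.X₁} (hw : IsConnecting k H S w)
    {w' : S'.X₃ ⟶ (cosyzygy k H).obj S'.X₁} (hw' : IsConnecting k H S' w') :
    (toStMod k H).map φ.τ₃ ≫ (toStMod k H).map w' =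
      (toStMod k H).map w ≫ (toStMod k H).map ((cosyzygy k H).map φ.τ₁) := by
  obtain ⟨v, hv, hvw⟩ := hw
  obtain ⟨v', hv', hvw'⟩ := hw'
  -- The two sides are the third components of two maps to the canonical sequence of `S'.X₁` with
  -- the same first component, so their difference factors through a coinduced module.
  let α : S ⟶ cosyzygySeq k H S'.X₁ :=
    { τ₁ := φ.τ₁
      τ₂ := φ.τ₂ ≫ v'
      τ₃ := φ.τ₃ ≫ w'
      comm₁₂ := by rw [← φ.comm₁₂_assoc, hv']
      comm₂₃ := by rw [Category.assoc, ← hvw', φ.comm₂₃_assoc] }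
  let β : S ⟶ cosyzygySeq k H S'.X₁ :=
    { τ₁ := φ.τ₁
      τ₂ := v ≫ (coindRes k H).map φ.τ₁
      τ₃ := w ≫ (cosyzygy k H).map φ.τ₁
      comm₁₂ := by
        rw [reassoc_of% hv]
        exact (embed k H).naturality φ.τ₁
      comm₂₃ := by
        rw [reassoc_of% hvw, Category.assoc]
        exact congrArg (v ≫ ·) ((toCosyzygy k H).naturality φ.τ₁) }
  obtain ⟨t, ht⟩ := exists_lift_sub_τ₃ hS α β rfl
  rw [← Functor.map_comp, ← Functor.map_comp, toStMod_map_eq_iff]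
  exact ⟨_, isHProj_coind k H _, t, _, ht⟩

/-- As in Schanuel's lemma, both middle terms are relatively injective, so the identity of `S.X₁`
extends to maps of sequences both ways. The composites differ from the identity on third terms by
maps through the `H`-projective middle terms. -/
theorem IsConnecting.isIso {S : ShortComplex (Rep.{u} k G)} (hS : relSplit k H S)
    (hP : isHProj k H S.X₂) {w : S.X₃ ⟶ (cosyzygy k H).obj S.X₁} (hw : IsConnecting k H S w) :
    IsIso ((toStMod k H).map w) := by
  obtain ⟨v, hv, hvw⟩ := hw
  obtain ⟨u, hu⟩ := (isFrobeniusPair k H).injective (relSplit_cosyzygySeq k H S.X₁) hP S.f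
  change (embed k H).app S.X₁ ≫ u = S.f at hu
  have hT := (relSplit_cosyzygySeq k H S.X₁).1
  have h0 : (embed k H).app S.X₁ ≫ u ≫ S.g = 0 := by rw [reassoc_of% hu, S.zero]
  let c : (cosyzygy k H).obj S.X₁ ⟶ S.X₃ := cokernel.desc _ _ h0
  have hc : (toCosyzygy k H).app S.X₁ ≫ c = u ≫ S.g := cokernel.π_desc _ _ h0
  let α : S ⟶ cosyzygySeq k H S.X₁ :=
    { τ₁ := 𝟙 _, τ₂ := v, τ₃ := w
      comm₁₂ := by rw [hv, Category.id_comp]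
      comm₂₃ := hvw.symm }
  let β : cosyzygySeq k H S.X₁ ⟶ S :=
    { τ₁ := 𝟙 _, τ₂ := u, τ₃ := c
      comm₁₂ := by rw [hu, Category.id_comp]
      comm₂₃ := hc.symm }
  obtain ⟨t, ht⟩ := exists_lift_sub_τ₃ hS.1 (α ≫ β) (𝟙 S) (Category.id_comp _)
  obtain ⟨t', ht'⟩ := exists_lift_sub_τ₃ hT (β ≫ α) (𝟙 _) (Category.id_comp _)
  refine ⟨(toStMod k H).map c, ?_, ?_⟩
  · rw [← Functor.map_comp, ← CategoryTheory.Functor.map_id, toStMod_map_eq_iff]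
    exact ⟨_, hP, t, _, ht⟩
  · rw [← Functor.map_comp, ← CategoryTheory.Functor.map_id, toStMod_map_eq_iff]
    exact ⟨_, isHProj_coind k H _, t', _, ht'⟩

variable (k H)

/-- The terms of the shifted complex. -/
noncomputable def shiftXIso (K : CochainComplex (HProj k H) ℤ) (n : ℤ) :
    ((underlying k H).obj K).X (n + 1) ≅ ((underlying k H).obj (K⟦(1 : ℤ)⟧)).X n :=
  Iso.refl _

omit [Finite G] in
theorem shiftXIso_hom_d (K : CochainComplex (HProj k H) ℤ) (n : ℤ) :
    (shiftXIso k H K n).hom ≫ ((underlying k H).obj (K⟦(1 : ℤ)⟧)).d n (n + 1) =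
      -((underlying k H).obj K).d (n + 1) (n + 1 + 1) ≫ (shiftXIso k H K (n + 1)).hom := by
  refine (Category.id_comp _).trans (Eq.trans ?_ (congrArg Neg.neg (Category.comp_id _).symm))
  change (isHProj k H).ι.map ((K⟦(1 : ℤ)⟧).d n (n + 1)) =
    -(isHProj k H).ι.map (K.d (n + 1) (n + 1 + 1))
  rw [CochainComplex.shiftFunctor_obj_d', ← Functor.map_neg]
  congr 1
  simp

omit [Finite G] in
theorem shiftXIso_hom_naturality {K L : CochainComplex (HProj k H) ℤ} (f : K ⟶ L) (n : ℤ) :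
    (shiftXIso k H K n).hom ≫ ((underlying k H).map (f⟦(1 : ℤ)⟧')).f n =
      ((underlying k H).map f).f (n + 1) ≫ (shiftXIso k H L n).hom :=
  (Category.id_comp _).trans (Category.comp_id _).symm

/-- The sequence `Z⁰(K) ⟶ K⁰ ⟶ Z⁰(K⟦1⟧)`. -/
noncomputable abbrev shiftSeq (K : CochainComplex (HProj k H) ℤ) : ShortComplex (Rep.{u} k G) :=
  shiftCyclesSeq (shiftXIso k H K) (shiftXIso_hom_d k H K) 0

variable {k H}

omit [Finite G] in
theorem relSplit_shiftSeq {K : CochainComplex (HProj k H) ℤ}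
    (hK : isTate k H ((HomotopyCategory.quotient _ _).obj K)) : relSplit k H (shiftSeq k H K) :=
  (relSplit k H).prop_of_iso (cyclesSeqIso _ _ 0) (isTate.relSplit k H hK 0)

/-- A chain map induces a map between the sequences `Z⁰(K) ⟶ K⁰ ⟶ Z⁰(K⟦1⟧)`. -/
noncomputable def shiftSeqMap {K L : CochainComplex (HProj k H) ℤ} (f : K ⟶ L) :
    shiftSeq k H K ⟶ shiftSeq k H L where
  τ₁ := HomologicalComplex.cyclesMap ((underlying k H).map f) 0
  τ₂ := ((underlying k H).map f).f 0
  τ₃ := HomologicalComplex.cyclesMap ((underlying k H).map (f⟦(1 : ℤ)⟧')) 0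
  comm₁₂ := HomologicalComplex.cyclesMap_i _ _
  comm₂₃ := by
    rw [← cancel_mono (((underlying k H).obj (L⟦(1 : ℤ)⟧)).iCycles 0)]
    change (((underlying k H).map f).f 0 ≫ toCyclesOfShift _ (shiftXIso_hom_d k H L) 0) ≫ _ =
      (toCyclesOfShift _ (shiftXIso_hom_d k H K) 0 ≫ _) ≫ _
    rw [Category.assoc, toCyclesOfShift_i, Category.assoc, HomologicalComplex.cyclesMap_i,
      toCyclesOfShift_i_assoc, Preadditive.comp_neg, Preadditive.neg_comp, Category.assoc,
      shiftXIso_hom_naturality, HomologicalComplex.Hom.comm_assoc]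

end

/-! ### `Z⁰` commutes with the suspensions -/

section

variable (k : Type u) [CommRing k] {G : Type u} [Group G] (H : Subgroup G)

/-- The shift in `Tate_H(kG)`, computed on complexes. -/
noncomputable def tateShiftIso (X : Tate k H) :
    (X⟦(1 : ℤ)⟧).obj ≅ (HomotopyCategory.quotient _ _).obj (X.obj.as⟦(1 : ℤ)⟧) :=
  ((isTate k H).ι.commShiftIso (1 : ℤ)).app X ≪≫
    (((HomotopyCategory.quotient (HProj k H) (ComplexShape.up ℤ)).commShiftIso
      (1 : ℤ)).app X.obj.as).symm

theorem tateShiftIso_hom_naturality {X Y : Tate k H} (f : X ⟶ Y) (f' : X.obj.as ⟶ Y.obj.as)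
    (hf : f.hom = (HomotopyCategory.quotient _ _).map f') :
    (f⟦(1 : ℤ)⟧').hom ≫ (tateShiftIso k H Y).hom =
      (tateShiftIso k H X).hom ≫ (HomotopyCategory.quotient _ _).map (f'⟦(1 : ℤ)⟧') := by
  have h1 : (f⟦(1 : ℤ)⟧').hom ≫ ((isTate k H).ι.commShiftIso (1 : ℤ)).hom.app Y =
      ((isTate k H).ι.commShiftIso (1 : ℤ)).hom.app X ≫ f.hom⟦(1 : ℤ)⟧' :=
    ((isTate k H).ι.commShiftIso (1 : ℤ)).hom.naturality f
  have h2 : f.hom⟦(1 : ℤ)⟧' ≫ ((HomotopyCategory.quotient (HProj k H)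
      (ComplexShape.up ℤ)).commShiftIso (1 : ℤ)).inv.app Y.obj.as =
      ((HomotopyCategory.quotient (HProj k H) (ComplexShape.up ℤ)).commShiftIso
        (1 : ℤ)).inv.app X.obj.as ≫ (HomotopyCategory.quotient _ _).map (f'⟦(1 : ℤ)⟧') := by
    rw [hf]
    exact ((HomotopyCategory.quotient (HProj k H) (ComplexShape.up ℤ)).commShiftIso
      (1 : ℤ)).inv.naturality f'
  calc (f⟦(1 : ℤ)⟧').hom ≫ (tateShiftIso k H Y).hom
    _ = ((f⟦(1 : ℤ)⟧').hom ≫ ((isTate k H).ι.commShiftIso (1 : ℤ)).hom.app Y) ≫ _ :=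
      (Category.assoc _ _ _).symm
    _ = _ := by rw [h1, Category.assoc]; exact congrArg (_ ≫ ·) h2
    _ = _ := (Category.assoc _ _ _).symm

variable [Finite G]

/-- The map `Z⁰(X⟦1⟧) ⟶ cosyzygy (Z⁰(X))`. -/
noncomputable def cyclesShiftToCosyzygy {K : CochainComplex (HProj k H) ℤ}
    (hK : isTate k H ((HomotopyCategory.quotient _ _).obj K)) :
    ((underlying k H).obj (K⟦(1 : ℤ)⟧)).cycles 0 ⟶
      (cosyzygy k H).obj (((underlying k H).obj K).cycles 0) :=
  -- By `IsConnecting.naturality` the stable class does not depend on this choice.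
  (exists_isConnecting (relSplit_shiftSeq hK)).choose

variable {k H} in
theorem isConnecting_cyclesShiftToCosyzygy {K : CochainComplex (HProj k H) ℤ}
    (hK : isTate k H ((HomotopyCategory.quotient _ _).obj K)) :
    IsConnecting k H (shiftSeq k H K) (cyclesShiftToCosyzygy k H hK) :=
  (exists_isConnecting (relSplit_shiftSeq hK)).choose_spec

variable {k H} in
theorem isIso_cyclesShiftToCosyzygy {K : CochainComplex (HProj k H) ℤ}
    (hK : isTate k H ((HomotopyCategory.quotient _ _).obj K)) :
    IsIso ((toStMod k H).map (cyclesShiftToCosyzygy k H hK)) :=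
  (isConnecting_cyclesShiftToCosyzygy hK).isIso (relSplit_shiftSeq hK)
    (isHProj_underlying_X k H K 0)

/-- The functor `Z⁰` commutes with the suspensions. -/
noncomputable def tateZ0ShiftIso :
    shiftFunctor (Tate k H) (1 : ℤ) ⋙ tateZ0 k H ≅ tateZ0 k H ⋙ suspension k H :=
  NatIso.ofComponents
    (fun X =>
      (cyclesZero k H).mapIso (tateShiftIso k H X) ≪≫
        @asIso _ _ _ _ ((toStMod k H).map (cyclesShiftToCosyzygy k H X.property))
          (isIso_cyclesShiftToCosyzygy X.property))
    (by
      intro X Y f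
      obtain ⟨f', hf⟩ := (HomotopyCategory.quotient _ _).map_surjective f.hom
      have h1 := congrArg (cyclesZero k H).map (tateShiftIso_hom_naturality k H f f' hf.symm)
      have h2 := IsConnecting.naturality (relSplit_shiftSeq X.property).1 (shiftSeqMap f')
        (isConnecting_cyclesShiftToCosyzygy X.property)
        (isConnecting_cyclesShiftToCosyzygy Y.property)
      rw [Functor.map_comp, Functor.map_comp] at h1
      refine (Category.assoc _ _ _).symm.trans ((congrArg (· ≫ _) h1).trans ?_)
      refine (Category.assoc _ _ _).trans (Eq.trans ?_ (Category.assoc _ _ _).symm)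
      refine congrArg (_ ≫ ·) (h2.trans (congrArg (_ ≫ ·) ?_))
      change _ = (suspension k H).map ((cyclesZero k H).map f.hom)
      rw [← hf]
      rfl)

end

/-! ### Transport of the triangulated structure -/

section

variable {C D : Type*} [Category C] [Category D] [Preadditive C] [HasZeroObject C] [HasShift C ℤ]
  [∀ n : ℤ, (shiftFunctor C n).Additive] [Pretriangulated C]

instance : (MorphismProperty.isomorphisms C).HasLeftCalculusOfFractions where
  exists_leftFraction X Y φ := by
    have : IsIso φ.s := φ.hs
    exact ⟨⟨inv φ.s ≫ φ.f, 𝟙 _, MorphismProperty.id_mem _ _⟩, by simp⟩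
  ext X' X Y f₁ f₂ s hs h := by
    have : IsIso s := hs
    exact ⟨_, 𝟙 _, MorphismProperty.id_mem _ _, by rw [(cancel_epi s).1 h]⟩

instance : (MorphismProperty.isomorphisms C).IsCompatibleWithTriangulation where
  condition n := by
    ext X Y f
    exact isIso_iff_of_reflects_iso f (shiftFunctor C n)
  compatible_with_triangulation T₁ T₂ h₁ h₂ a b ha hb hab := by
    obtain ⟨c, hc₁, hc₂⟩ := complete_distinguished_triangle_morphism T₁ T₂ h₁ h₂ a b hab
    exact ⟨c, isIso₃_of_isIso₁₂ (Triangle.homMk _ _ a b c hab hc₁ hc₂) h₁ h₂ ha hb, hc₁, hc₂⟩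

variable [Preadditive D] [HasZeroObject D] (L : C ⥤ D) [L.Additive] [L.IsEquivalence]
  [IsTriangulated C]

/-- A triangulated structure can be transported along an equivalence. -/
theorem exists_pretriangulated_of_equivalence :
    ∃ (_ : HasShift D ℤ) (_ : ∀ n : ℤ, (shiftFunctor D n).Additive) (_ : Pretriangulated D)
      (_ : L.CommShift ℤ), IsTriangulated D ∧ L.IsTriangulated := by
  -- An equivalence is a localization at the isomorphisms, so the triangulated structure on
  -- localizations applies.
  have : L.IsLocalization (MorphismProperty.isomorphisms C) :=
    Functor.IsLocalization.of_isEquivalence L _ le_rfl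
  let : HasShift D ℤ := HasShift.localized L (MorphismProperty.isomorphisms C) ℤ
  let : L.CommShift ℤ := Functor.CommShift.localized L (MorphismProperty.isomorphisms C) ℤ
  have h (n : ℤ) : (shiftFunctor D n).Additive := by
    rw [Localization.functor_additive_iff L (MorphismProperty.isomorphisms C)]
    exact Functor.additive_of_iso (L.commShiftIso n)
  let : Pretriangulated D :=
    Triangulated.Localization.pretriangulated L (MorphismProperty.isomorphisms C)
  have : L.IsTriangulated :=
    Triangulated.Localization.isTriangulated_functor L (MorphismProperty.isomorphisms C)
  exact ⟨inferInstance, h, inferInstance, inferInstance,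
    Triangulated.Localization.isTriangulated L (MorphismProperty.isomorphisms C), this⟩

end

/-! ### Cocycles of degreewise split sequences -/

section

variable {C : Type*} [Category C] [Abelian C] {K₁ K₂ K₃ : CochainComplex C ℤ}
  (f : K₁ ⟶ K₂) (g : K₂ ⟶ K₃) (w : f ≫ g = 0)
  {r : ∀ n, K₂.X n ⟶ K₁.X n} {s : ∀ n, K₃.X n ⟶ K₂.X n}
  (hf : ∀ n, f.f n ≫ r n = 𝟙 _) (hg : ∀ n, s n ≫ g.f n = 𝟙 _)
  (hid : ∀ n, r n ≫ f.f n + g.f n ≫ s n = 𝟙 _)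

/-- The cocycles of a short complex of cochain complexes. -/
noncomputable abbrev cyclesShortComplex (n : ℤ) : ShortComplex C :=
  ShortComplex.mk (HomologicalComplex.cyclesMap f n) (HomologicalComplex.cyclesMap g n) (by
    rw [← HomologicalComplex.cyclesMap_comp, w, HomologicalComplex.cyclesMap_zero])

include hf hg hid in
/-- Cocycles preserve the exactness of degreewise split sequences if the last complex is exact. -/
theorem cyclesShortComplex_shortExact (m n : ℤ) (h : Epi (K₃.toCycles m n)) :
    (cyclesShortComplex f g w n).ShortExact := by
  have hm (i : ℤ) : Mono (f.f i) := (SplitMono.mk (r i) (hf i)).mono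
  have he (i : ℤ) : Epi (g.f i) := (SplitEpi.mk (s i) (hg i)).epi
  have hmono : Mono (HomologicalComplex.cyclesMap f n) := by
    have : Mono (HomologicalComplex.cyclesMap f n ≫ K₂.iCycles n) := by
      rw [HomologicalComplex.cyclesMap_i]
      infer_instance
    exact mono_of_mono _ (K₂.iCycles n)
  have hepi : Epi (HomologicalComplex.cyclesMap g n) := by
    have : Epi (K₂.toCycles m n ≫ HomologicalComplex.cyclesMap g n) := by
      have h3 : K₂.toCycles m n ≫ HomologicalComplex.cyclesMap g n =
          g.f m ≫ K₃.toCycles m n := by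
        rw [← cancel_mono (K₃.iCycles n)]
        simp
      rw [h3]
      infer_instance
    exact epi_of_epi (K₂.toCycles m n) _
  have hex : (cyclesShortComplex f g w n).Exact := by
    refine ShortComplex.exact_of_f_is_kernel _ (KernelFork.IsLimit.ofι' _ _ fun {W} a ha => ?_)
    have h1 : a ≫ K₂.iCycles n ≫ g.f n = 0 := by
      rw [← HomologicalComplex.cyclesMap_i]
      exact (reassoc_of% ha) _ |>.trans zero_comp
    have h2 : (a ≫ K₂.iCycles n ≫ r n) ≫ f.f n = a ≫ K₂.iCycles n := by
      have := congrArg (fun t => (a ≫ K₂.iCycles n) ≫ t) (hid n)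
      simpa [reassoc_of% h1] using this
    refine ⟨K₁.liftCycles (a ≫ K₂.iCycles n ≫ r n) (n + 1) (by simp) ?_, ?_⟩
    · rw [← cancel_mono (f.f (n + 1)), Category.assoc, ← f.comm, ← Category.assoc, h2]
      simp
    · rw [← cancel_mono (K₂.iCycles n)]
      simpa using h2
  exact { exact := hex, mono_f := hmono, epi_g := hepi }

variable {B : CochainComplex C ℤ} (φ : ∀ n, K₁.X (n + 1) ≅ B.X n)
  (hφ : ∀ n, (φ n).hom ≫ B.d n (n + 1) = -K₁.d (n + 1) (n + 1 + 1) ≫ (φ (n + 1)).hom)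
  (n : ℤ) (δ : K₃ ⟶ B) (hδ : δ.f n = s n ≫ K₂.d n (n + 1) ≫ r (n + 1) ≫ (φ n).hom)

/-- The comparison of the cocycles of a degreewise split sequence with those of the shift. -/
noncomputable def cyclesShortComplexToShift :
    cyclesShortComplex f g w n ⟶ shiftCyclesSeq φ hφ n where
  τ₁ := 𝟙 _
  τ₂ := K₂.iCycles n ≫ r n
  τ₃ := HomologicalComplex.cyclesMap δ n
  comm₁₂ := by
    simp [hf]
  comm₂₃ := by
    rw [← cancel_mono (B.iCycles n)]
    -- On cocycles this turns `g s d r` into `-r d`, because `d` vanishes there and `f r = 1`.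
    have h1 : g.f n ≫ s n = 𝟙 _ - r n ≫ f.f n := by rw [← hid n]; abel
    simp [toCyclesOfShift_i, hδ, reassoc_of% h1, reassoc_of% hf]

end

/-! ### Connecting maps on cocycles -/

section

variable {k : Type u} [CommRing k] {G : Type u} [Group G] {H : Subgroup G}

/-- The retraction goes from `Zⁿ(K₂)` to `K₁ⁿ` by `r`, then over `H` onto `Zⁿ(K₁)`. -/
theorem relSplit_cyclesShortComplex {K₁ K₂ K₃ : CochainComplex (Rep.{u} k G) ℤ}
    {f : K₁ ⟶ K₂} {g : K₂ ⟶ K₃} {w : f ≫ g = 0} (n : ℤ)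
    (hS : (cyclesShortComplex f g w n).ShortExact) (h₁ : relSplit k H (cyclesSeq K₁ n))
    (r : K₂.X n ⟶ K₁.X n) (hr : f.f n ≫ r = 𝟙 _) :
    relSplit k H (cyclesShortComplex f g w n) := by
  obtain ⟨ρ, hρ⟩ : ∃ ρ : (resH k H).obj (K₁.X n) ⟶ (resH k H).obj (K₁.cycles n),
      (resH k H).map (K₁.iCycles n) ≫ ρ = 𝟙 _ := h₁.exists_retraction
  refine relSplit_of_retraction k H hS ((resH k H).map (K₂.iCycles n ≫ r) ≫ ρ) ?_
  change (resH k H).map (HomologicalComplex.cyclesMap f n) ≫ (resH k H).map _ ≫ _ = 𝟙 _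
  rw [← Functor.map_comp_assoc, HomologicalComplex.cyclesMap_i_assoc, hr, Category.comp_id]
  exact hρ

variable [Finite G] {S : ShortComplex (CochainComplex (HProj k H) ℤ)}
  (σ : ∀ n, (S.map (HomologicalComplex.eval (HProj k H) _ n)).Splitting)
  (h₁ : isTate k H ((HomotopyCategory.quotient _ _).obj S.X₁))
  (h₃ : isTate k H ((HomotopyCategory.quotient _ _).obj S.X₃))

include σ h₁ h₃

/-- `cyclesShortComplexToShift` is the identity on first terms and the degreewise split connecting
map on third terms, so naturality of connecting maps gives the equality. -/
theorem exists_connecting_cycles :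
    ∃ (hw : (underlying k H).map S.f ≫ (underlying k H).map S.g = 0)
      (w : ((underlying k H).obj S.X₃).cycles 0 ⟶
        (cosyzygy k H).obj (((underlying k H).obj S.X₁).cycles 0)),
      relSplit k H (cyclesShortComplex _ _ hw 0) ∧
      IsConnecting k H (cyclesShortComplex _ _ hw 0) w ∧
      (cyclesZero k H).map ((HomotopyCategory.quotient _ _).map
        (CochainComplex.homOfDegreewiseSplit S σ)) ≫
        (toStMod k H).map (cyclesShiftToCosyzygy k H h₁) = (toStMod k H).map w := by
  let r (n : ℤ) : ((underlying k H).obj S.X₂).X n ⟶ ((underlying k H).obj S.X₁).X n :=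
    (isHProj k H).ι.map (σ n).r
  let s (n : ℤ) : ((underlying k H).obj S.X₃).X n ⟶ ((underlying k H).obj S.X₂).X n :=
    (isHProj k H).ι.map (σ n).s
  have hf (n : ℤ) : ((underlying k H).map S.f).f n ≫ r n = 𝟙 _ :=
    ((σ n).map (isHProj k H).ι).f_r
  have hg (n : ℤ) : s n ≫ ((underlying k H).map S.g).f n = 𝟙 _ :=
    ((σ n).map (isHProj k H).ι).s_g
  have hid (n : ℤ) : r n ≫ ((underlying k H).map S.f).f n +
      ((underlying k H).map S.g).f n ≫ s n = 𝟙 _ :=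
    ((σ n).map (isHProj k H).ι).id
  have hw : (underlying k H).map S.f ≫ (underlying k H).map S.g = 0 := by
    rw [← Functor.map_comp, S.zero, Functor.map_zero]
  have hδ : ((underlying k H).map (CochainComplex.homOfDegreewiseSplit S σ)).f 0 =
      s 0 ≫ ((underlying k H).obj S.X₂).d 0 (0 + 1) ≫ r (0 + 1) ≫
        (shiftXIso k H S.X₁ 0).hom := by
    have : (shiftXIso k H S.X₁ 0).hom = 𝟙 (((underlying k H).obj S.X₁).X (0 + 1)) := rfl
    rw [this]
    erw [Category.comp_id]
    change (isHProj k H).ι.map ((CochainComplex.homOfDegreewiseSplit S σ).f 0) = _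
    rw [CochainComplex.homOfDegreewiseSplit_f]
    rfl
  -- Degree `-1` enters because surjectivity on `Z⁰` needs every 0-cocycle of the last complex to be
  -- a coboundary.
  have hS := cyclesShortComplex_shortExact _ _ hw hf hg hid (-1) 0 (by
    exact (isTate.relSplit k H h₃ (-1)).1.epi_g)
  have hS' := relSplit_cyclesShortComplex (H := H) 0 hS (isTate.relSplit k H h₁ 0) (r 0) (hf 0)
  obtain ⟨w, hcw⟩ := exists_isConnecting hS'
  refine ⟨hw, w, hS', hcw, ?_⟩
  have := IsConnecting.naturality hS
    (cyclesShortComplexToShift _ _ hw hf hid _ (shiftXIso_hom_d k H S.X₁) 0 _ hδ) hcw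
    (isConnecting_cyclesShiftToCosyzygy h₁)
  refine this.trans ?_
  change _ ≫ (toStMod k H).map ((cosyzygy k H).map (𝟙 _)) = _
  rw [CategoryTheory.Functor.map_id, CategoryTheory.Functor.map_id, Category.comp_id]

end

/-! ### Standard triangles and their uniqueness -/

theorem comp_inv_app_comp_map {C D : Type*} [Category C] [Category D] {F F' : C ⥤ D} (e : F ≅ F')
    {A A' : C} {Z Z' : D} {w : Z ⟶ F'.obj A} {w' : Z' ⟶ F'.obj A'} {a : A ⟶ A'} {c : Z ⟶ Z'}
    (h : c ≫ w' = w ≫ F'.map a) : (w ≫ e.inv.app A) ≫ F.map a = c ≫ w' ≫ e.inv.app A' := by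
  rw [reassoc_of% h, Category.assoc, e.inv.naturality]

theorem isIso_of_sub_id_comp_self {D : Type*} [Category D] [Preadditive D] {X : D} {f : X ⟶ X}
    (h : (f - 𝟙 X) ≫ (f - 𝟙 X) = 0) : IsIso f := by
  simp only [Preadditive.comp_sub, Preadditive.sub_comp, Category.comp_id, Category.id_comp] at h
  refine ⟨𝟙 X - (f - 𝟙 X), ?_, ?_⟩ <;>
  · simp only [Preadditive.comp_sub, Preadditive.sub_comp, Category.comp_id, Category.id_comp]
    rw [← sub_eq_zero, ← neg_eq_zero, ← h]
    abel

section

variable {k : Type u} [CommRing k] {G : Type u} [Group G] {H : Subgroup G} [Finite G]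

/-- The connecting map is a weak cokernel of the second map of a sequence that splits over `H`. -/
theorem exists_eq_comp_connecting {S : ShortComplex (Rep.{u} k G)} (hS : relSplit k H S)
    {w : S.X₃ ⟶ (cosyzygy k H).obj S.X₁} (hw : IsConnecting k H S w) {M : Rep.{u} k G}
    (ε : S.X₃ ⟶ M) (hε : (toStMod k H).map (S.g ≫ ε) = 0) :
    ∃ z : (cosyzygy k H).obj S.X₁ ⟶ M,
      (toStMod k H).map ε = (toStMod k H).map w ≫ (toStMod k H).map z := by
  rw [← (toStMod k H).map_zero, toStMod_map_eq_iff] at hε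
  obtain ⟨P, hP, x, y, hxy⟩ := hε
  rw [sub_zero] at hxy
  obtain ⟨v, hv, hvw⟩ := hw
  -- With `q` extending `S.f ≫ x`, the map `x - v ≫ q` descends to `t` on `S.X₃`, and `q ≫ y`
  -- descends to `z`; then `ε - w ≫ z = t ≫ y`.
  obtain ⟨q, hq⟩ := (isFrobeniusPair k H).injective (relSplit_cosyzygySeq k H S.X₁) hP (S.f ≫ x)
  change (embed k H).app S.X₁ ≫ q = S.f ≫ x at hq
  have := hS.1.epi_g
  have h0 : S.f ≫ (x - v ≫ q) = 0 := by
    rw [Preadditive.comp_sub, reassoc_of% hv, hq, sub_self]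
  obtain ⟨t, ht⟩ : ∃ t : S.X₃ ⟶ P, S.g ≫ t = x - v ≫ q :=
    ⟨hS.1.exact.desc _ h0, hS.1.exact.g_desc _ h0⟩
  have h1 : (embed k H).app S.X₁ ≫ q ≫ y = 0 := by
    rw [reassoc_of% hq, hxy, S.zero_assoc, zero_comp]
  let z : (cosyzygy k H).obj S.X₁ ⟶ M := cokernel.desc _ _ h1
  have hz : (toCosyzygy k H).app S.X₁ ≫ z = q ≫ y := cokernel.π_desc _ _ h1
  refine ⟨z, ?_⟩
  rw [← Functor.map_comp, toStMod_map_eq_iff]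
  refine ⟨P, hP, t, y, ?_⟩
  rw [← cancel_epi S.g, reassoc_of% ht, Preadditive.comp_sub, reassoc_of% hvw, hz,
    Preadditive.sub_comp, hxy, Category.assoc]

/-- Stably commutative squares between sequences that split over `H` can be made commutative. -/
theorem exists_shortComplex_hom {S S' : ShortComplex (Rep.{u} k G)} (hS : relSplit k H S)
    (a : (toStMod k H).obj S.X₁ ⟶ (toStMod k H).obj S'.X₁)
    (b : (toStMod k H).obj S.X₂ ⟶ (toStMod k H).obj S'.X₂)
    (hab : (toStMod k H).map S.f ≫ b = a ≫ (toStMod k H).map S'.f) :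
    ∃ φ : S ⟶ S', (toStMod k H).map φ.τ₁ = a ∧ (toStMod k H).map φ.τ₂ = b := by
  obtain ⟨a, rfl⟩ := (toStMod k H).map_surjective a
  obtain ⟨b, rfl⟩ := (toStMod k H).map_surjective b
  rw [← Functor.map_comp, ← Functor.map_comp, toStMod_map_eq_iff] at hab
  obtain ⟨P, hP, x, y, hxy⟩ := hab
  -- The defect `x ≫ y` of the square is absorbed by subtracting from `b` the stably trivial map `x'
  -- ≫ y`.
  obtain ⟨x', hx'⟩ := (isFrobeniusPair k H).injective hS hP x
  have := hS.1.epi_g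
  have h1 : S.f ≫ (b - x' ≫ y) = a ≫ S'.f := by
    rw [Preadditive.comp_sub, reassoc_of% hx', hxy, sub_sub_cancel]
  have h2 : S.f ≫ (b - x' ≫ y) ≫ S'.g = 0 := by
    rw [reassoc_of% h1, S'.zero, comp_zero]
  refine ⟨⟨a, b - x' ≫ y, hS.1.exact.desc _ h2, h1.symm, (hS.1.exact.g_desc _ h2).symm⟩, rfl, ?_⟩
  rw [toStMod_map_eq_iff]
  exact ⟨P, hP, -x', y, by simp⟩

/-- The standard triangle of a sequence with a connecting map. -/
noncomputable abbrev relTriangle [HasShift (StMod k H) ℤ]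
    (e : shiftFunctor (StMod k H) (1 : ℤ) ≅ suspension k H) (S : ShortComplex (Rep.{u} k G))
    (w : S.X₃ ⟶ (cosyzygy k H).obj S.X₁) : Triangle (StMod k H) :=
  Triangle.mk ((toStMod k H).map S.f) ((toStMod k H).map S.g)
    ((toStMod k H).map w ≫ e.inv.app ((toStMod k H).obj S.X₁))

theorem relDistTriangles_iff [HasShift (StMod k H) ℤ]
    (e : shiftFunctor (StMod k H) (1 : ℤ) ≅ suspension k H) (T : Triangle (StMod k H)) :
    T ∈ relDistTriangles k H e ↔ ∃ (S : ShortComplex (Rep.{u} k G)) (w : _),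
      relSplit k H S ∧ IsConnecting k H S w ∧ Nonempty (T ≅ relTriangle e S w) :=
  ⟨fun ⟨S, hS, hS', v, w, hv, hw, hT⟩ => ⟨S, w, ⟨hS, hS'⟩, ⟨v, hv, hw⟩, hT⟩,
    fun ⟨S, w, ⟨hS, hS'⟩, ⟨v, hv, hw⟩, hT⟩ => ⟨S, hS, hS', v, w, hv, hw, hT⟩⟩

theorem IsConnecting.naturality_inv_app [HasShift (StMod k H) ℤ]
    (e : shiftFunctor (StMod k H) (1 : ℤ) ≅ suspension k H) {S S' : ShortComplex (Rep.{u} k G)}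
    (hS : relSplit k H S) {w : S.X₃ ⟶ (cosyzygy k H).obj S.X₁} (hw : IsConnecting k H S w)
    {w' : S'.X₃ ⟶ (cosyzygy k H).obj S'.X₁} (hw' : IsConnecting k H S' w') (φ : S ⟶ S') :
    ((toStMod k H).map w ≫ e.inv.app ((toStMod k H).obj S.X₁)) ≫
        (shiftFunctor (StMod k H) (1 : ℤ)).map ((toStMod k H).map φ.τ₁) =
      (toStMod k H).map φ.τ₃ ≫ (toStMod k H).map w' ≫ e.inv.app ((toStMod k H).obj S'.X₁) :=
  comp_inv_app_comp_map (F' := suspension k H) (A := (toStMod k H).obj S.X₁)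
    (A' := (toStMod k H).obj S'.X₁) (w := (toStMod k H).map w) (w' := (toStMod k H).map w') e
    (IsConnecting.naturality hS.1 φ hw hw')

/-- A morphism of sequences induces a morphism of standard triangles. -/
noncomputable def relTriangleMap [HasShift (StMod k H) ℤ]
    (e : shiftFunctor (StMod k H) (1 : ℤ) ≅ suspension k H) {S S' : ShortComplex (Rep.{u} k G)}
    (hS : relSplit k H S) {w : S.X₃ ⟶ (cosyzygy k H).obj S.X₁} (hw : IsConnecting k H S w)
    {w' : S'.X₃ ⟶ (cosyzygy k H).obj S'.X₁} (hw' : IsConnecting k H S' w') (φ : S ⟶ S') :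
    relTriangle e S w ⟶ relTriangle e S' w' where
  hom₁ := (toStMod k H).map φ.τ₁
  hom₂ := (toStMod k H).map φ.τ₂
  hom₃ := (toStMod k H).map φ.τ₃
  comm₁ := by
    change (toStMod k H).map S.f ≫ _ = _ ≫ (toStMod k H).map S'.f
    rw [← Functor.map_comp, ← Functor.map_comp, φ.comm₁₂]
  comm₂ := by
    change (toStMod k H).map S.g ≫ _ = _ ≫ (toStMod k H).map S'.g
    rw [← Functor.map_comp, ← Functor.map_comp, φ.comm₂₃]
  comm₃ := by
    exact IsConnecting.naturality_inv_app e hS hw hw' φ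

variable [HasShift (StMod k H) ℤ] [∀ n : ℤ, (shiftFunctor (StMod k H) n).Additive]
  [Pretriangulated (StMod k H)]
  (e : shiftFunctor (StMod k H) (1 : ℤ) ≅ suspension k H)

/-- A standard triangle is distinguished if a standard triangle with an isomorphic first map is. -/
theorem relTriangle_distinguished_of_iso {S S' : ShortComplex (Rep.{u} k G)}
    (hS : relSplit k H S) {w : S.X₃ ⟶ (cosyzygy k H).obj S.X₁} (hw : IsConnecting k H S w)
    (hS' : relSplit k H S') {w' : S'.X₃ ⟶ (cosyzygy k H).obj S'.X₁}
    (hw' : IsConnecting k H S' w') (hT' : relTriangle e S' w' ∈ distTriang (StMod k H))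
    (a : (toStMod k H).obj S.X₁ ≅ (toStMod k H).obj S'.X₁)
    (b : (toStMod k H).obj S.X₂ ≅ (toStMod k H).obj S'.X₂)
    (hab : (toStMod k H).map S.f ≫ b.hom = a.hom ≫ (toStMod k H).map S'.f) :
    relTriangle e S w ∈ distTriang (StMod k H) := by
  obtain ⟨φ, hφ₁, hφ₂⟩ := exists_shortComplex_hom hS a.hom b.hom hab
  obtain ⟨ψ, hψ₁, hψ₂⟩ := exists_shortComplex_hom hS' a.inv b.inv
    (by rw [← cancel_epi a.hom, ← reassoc_of% hab]; simp)
  let α : relTriangle e S w ⟶ relTriangle e S' w' := relTriangleMap e hS hw hw' φ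
  let β : relTriangle e S' w' ⟶ relTriangle e S w := relTriangleMap e hS' hw' hw ψ
  -- This composite is an endomorphism of a distinguished triangle, so the triangulated five lemma
  -- applies.
  have h₁ : IsIso (β ≫ α).hom₃ := isIso₃_of_isIso₁₂ (β ≫ α) hT' hT'
    (by
      have : (β ≫ α).hom₁ = 𝟙 _ :=
        (congrArg₂ (· ≫ ·) hψ₁ hφ₁).trans a.inv_hom_id
      rw [this]; infer_instance)
    (by
      have : (β ≫ α).hom₂ = 𝟙 _ :=
        (congrArg₂ (· ≫ ·) hψ₂ hφ₂).trans b.inv_hom_id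
      rw [this]; infer_instance)
  -- The triangle of `S` is not yet known to be distinguished. Instead, `γ.τ₃ - 𝟙` is stably killed
  -- by precomposing `S.g`, so it factors through `w`, and it is killed by postcomposing `w`; hence
  -- its square is zero.
  have h₂ : IsIso (α ≫ β).hom₃ := by
    let γ := φ ≫ ψ
    have h1 : (toStMod k H).map γ.τ₁ = 𝟙 _ := by
      change (toStMod k H).map (φ.τ₁ ≫ ψ.τ₁) = _
      rw [Functor.map_comp, hφ₁, hψ₁, a.hom_inv_id]
    have h2 : (toStMod k H).map γ.τ₂ = 𝟙 _ := by
      change (toStMod k H).map (φ.τ₂ ≫ ψ.τ₂) = _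
      rw [Functor.map_comp, hφ₂, hψ₂, b.hom_inv_id]
    have h3 : (toStMod k H).map (γ.τ₃ - 𝟙 _) ≫ (toStMod k H).map w = 0 := by
      have := IsConnecting.naturality hS.1 γ hw hw
      have h1' : (toStMod k H).map ((cosyzygy k H).map γ.τ₁) = 𝟙 _ :=
        (congrArg (suspension k H).map h1).trans ((suspension k H).map_id _)
      rw [Functor.map_sub, Preadditive.sub_comp, this, h1']
      simp
    have h4 : (toStMod k H).map (S.g ≫ (γ.τ₃ - 𝟙 _)) = 0 := by
      rw [Preadditive.comp_sub, ← γ.comm₂₃, Functor.map_sub, Functor.map_comp, h2]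
      simp
    obtain ⟨z, hz⟩ := exists_eq_comp_connecting hS hw _ h4
    have h5 : (toStMod k H).map (γ.τ₃ - 𝟙 _) ≫ (toStMod k H).map (γ.τ₃ - 𝟙 _) = 0 := by
      nth_rw 2 [hz]
      rw [reassoc_of% h3, zero_comp]
    rw [Functor.map_sub, CategoryTheory.Functor.map_id] at h5
    change IsIso ((toStMod k H).map φ.τ₃ ≫ (toStMod k H).map ψ.τ₃)
    rw [← Functor.map_comp]
    exact isIso_of_sub_id_comp_self h5
  have : IsIso α.hom₃ := by
    have e1 : β.hom₃ ≫ α.hom₃ = (β ≫ α).hom₃ := rfl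
    have e2 : α.hom₃ ≫ β.hom₃ = (α ≫ β).hom₃ := rfl
    have : IsIso (β.hom₃ ≫ α.hom₃) := h₁
    have : IsIso (α.hom₃ ≫ β.hom₃) := h₂
    have : IsSplitEpi α.hom₃ := IsSplitEpi.mk' ⟨inv (β.hom₃ ≫ α.hom₃) ≫ β.hom₃, by simp⟩
    have : Mono α.hom₃ := mono_of_mono α.hom₃ β.hom₃
    exact isIso_of_mono_of_isSplitEpi _
  have : IsIso α.hom₁ := by
    change IsIso ((toStMod k H).map φ.τ₁)
    rw [hφ₁]; infer_instance
  have : IsIso α.hom₂ := by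
    change IsIso ((toStMod k H).map φ.τ₂)
    rw [hφ₂]; infer_instance
  have : IsIso α := Triangle.isIso_of_isIsos _ inferInstance inferInstance inferInstance
  exact isomorphic_distinguished _ hT' _ (asIso α)

end

/-! ### Image of the distinguished triangles under `Z⁰` -/

theorem comp_map_eq_comp_inv_app {C D : Type*} [Category C] [Category D] {F F' : C ⥤ D}
    (e : F ≅ F') {A A' : C} {Z : D} {Z' : D} {u : Z ⟶ Z'} {c : Z' ⟶ F.obj A} {a : A ⟶ A'}
    {v : Z ⟶ F'.obj A'} {η : Z' ⟶ F'.obj A} (hη : c ≫ e.hom.app A = η)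
    (h : u ≫ η ≫ F'.map a = v) : (u ≫ c) ≫ F.map a = v ≫ e.inv.app A' := by
  simp [← h, ← hη]

theorem map_comp_map_comp_map {C D : Type*} [Category C] [Category D] (F : C ⥤ D)
    {X₁ X₂ X₃ X₄ Y : C} {a : X₁ ⟶ X₂} {b : X₂ ⟶ X₃} {c : X₃ ⟶ X₄} {d : X₁ ⟶ Y} {q : Y ⟶ X₄}
    (h : a ≫ b ≫ c = d ≫ q) {Z : D} (t : F.obj X₄ ⟶ Z) :
    F.map a ≫ F.map b ≫ F.map c ≫ t = F.map d ≫ F.map q ≫ t := by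
  simp only [← Functor.map_comp_assoc, h]

section

variable (k : Type u) [CommRing k] {G : Type u} [Group G] (H : Subgroup G)

instance : (isTate k H).IsClosedUnderIsomorphisms := by
  rw [isTate_eq]
  infer_instance

end

section

variable {k : Type u} [CommRing k] {G : Type u} [Group G] {H : Subgroup G} [Finite G]
  [HasShift (StMod k H) ℤ] [(tateZ0 k H).CommShift ℤ]

variable (k H) in
/-- The shift of `StMod_H(kG)` is identified with the suspension through the functor `Z⁰`. -/
theorem exists_shiftFunctor_iso_suspension :
    ∃ e : shiftFunctor (StMod k H) (1 : ℤ) ≅ suspension k H, ∀ X : Tate k H,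
      ((tateZ0 k H).commShiftIso (1 : ℤ)).hom.app X ≫ e.hom.app ((tateZ0 k H).obj X) =
        (tateZ0ShiftIso k H).hom.app X := by
  have : (tateZ0 k H).IsLocalization (MorphismProperty.isomorphisms (Tate k H)) :=
    Functor.IsLocalization.of_isEquivalence _ _ le_rfl
  have := Localization.full_whiskeringLeft (tateZ0 k H)
    (MorphismProperty.isomorphisms (Tate k H)) (StMod k H)
  have := Localization.faithful_whiskeringLeft (tateZ0 k H)
    (MorphismProperty.isomorphisms (Tate k H)) (StMod k H)
  let i : tateZ0 k H ⋙ shiftFunctor (StMod k H) (1 : ℤ) ≅ tateZ0 k H ⋙ suspension k H :=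
    ((tateZ0 k H).commShiftIso (1 : ℤ)).symm ≪≫ tateZ0ShiftIso k H
  -- Precomposition with a localization functor is fully faithful, so the isomorphism descends from
  -- `Tate_H(kG)`.
  refine ⟨((Functor.whiskeringLeft _ _ _).obj (tateZ0 k H)).preimageIso i, fun X => ?_⟩
  have h : Functor.whiskerLeft (tateZ0 k H)
      (((Functor.whiskeringLeft _ _ _).obj (tateZ0 k H)).preimageIso i).hom = i.hom :=
    ((Functor.whiskeringLeft _ _ _).obj (tateZ0 k H)).map_preimage i.hom
  have h' := NatTrans.congr_app h X
  refine (congrArg (_ ≫ ·) h').trans ?_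
  exact Iso.hom_inv_id_app_assoc ((tateZ0 k H).commShiftIso (1 : ℤ)) X _

-- The shift isomorphism of the quotient functor in the third map of the model triangle cancels
-- against its inverse in `tateShiftIso`, leaving the class of a chain map, to which `Z⁰` can be
-- applied.
omit [Finite G] [HasShift (StMod k H) ℤ] [(tateZ0 k H).CommShift ℤ] in
theorem mor₃_comp_tateShiftIso {T : Triangle (Tate k H)}
    {S : ShortComplex (CochainComplex (HProj k H) ℤ)}
    (σ : ∀ n, (S.map (HomologicalComplex.eval (HProj k H) _ n)).Splitting)
    (i : (isTate k H).ι.mapTriangle.obj T ⟶ CochainComplex.trianglehOfDegreewiseSplit S σ)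
    {h₁ : isTate k H ((HomotopyCategory.quotient _ _).obj S.X₁)}
    (f : T.obj₁ ⟶ ⟨(HomotopyCategory.quotient _ _).obj S.X₁, h₁⟩) (hf : f.hom = i.hom₁) :
    T.mor₃.hom ≫ (f⟦(1 : ℤ)⟧').hom ≫ (tateShiftIso k H _).hom =
      i.hom₃ ≫ (HomotopyCategory.quotient _ _).map (CochainComplex.homOfDegreewiseSplit S σ) := by
  have h1 : (f⟦(1 : ℤ)⟧').hom ≫ ((isTate k H).ι.commShiftIso (1 : ℤ)).hom.app _ =
      ((isTate k H).ι.commShiftIso (1 : ℤ)).hom.app _ ≫ f.hom⟦(1 : ℤ)⟧' :=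
    ((isTate k H).ι.commShiftIso (1 : ℤ)).hom.naturality f
  have h2 : (T.mor₃.hom ≫ ((isTate k H).ι.commShiftIso (1 : ℤ)).hom.app _) ≫ f.hom⟦(1 : ℤ)⟧' =
      i.hom₃ ≫ (HomotopyCategory.quotient _ _).map (CochainComplex.homOfDegreewiseSplit S σ) ≫
        ((HomotopyCategory.quotient (HProj k H) (ComplexShape.up ℤ)).commShiftIso
          (1 : ℤ)).hom.app S.X₁ := by
    rw [hf]
    exact i.comm₃
  have h3 : ((HomotopyCategory.quotient (HProj k H) (ComplexShape.up ℤ)).commShiftIso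
      (1 : ℤ)).hom.app S.X₁ ≫ ((HomotopyCategory.quotient (HProj k H)
      (ComplexShape.up ℤ)).commShiftIso (1 : ℤ)).inv.app S.X₁ = 𝟙 _ :=
    Iso.hom_inv_id_app _ _
  have h4 : (f⟦(1 : ℤ)⟧').hom ≫ (tateShiftIso k H _).hom =
      ((isTate k H).ι.commShiftIso (1 : ℤ)).hom.app _ ≫ f.hom⟦(1 : ℤ)⟧' ≫
        ((HomotopyCategory.quotient (HProj k H) (ComplexShape.up ℤ)).commShiftIso
          (1 : ℤ)).inv.app S.X₁ := by
    rw [← Category.assoc, ← h1, Category.assoc]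
    rfl
  rw [h4]
  refine Eq.trans ?_ (congrArg (· ≫ ((HomotopyCategory.quotient (HProj k H)
    (ComplexShape.up ℤ)).commShiftIso (1 : ℤ)).inv.app S.X₁) h2 |>.trans ?_)
  · simp only [Category.assoc]
    rfl
  · exact (Category.assoc _ _ _).trans (congrArg (i.hom₃ ≫ ·) ((Category.assoc _ _ _).trans
      ((congrArg (_ ≫ ·) h3).trans (Category.comp_id _))))

/-- A triangle of `K(H-Proj)` is modelled on a degreewise split sequence, and
`exists_connecting_cycles` identifies its image. The compatibility `he` makes the third square
commute with the correct shift isomorphism. -/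
theorem mapTriangle_mem_relDistTriangles
    (e : shiftFunctor (StMod k H) (1 : ℤ) ≅ suspension k H)
    (he : ∀ X : Tate k H,
      ((tateZ0 k H).commShiftIso (1 : ℤ)).hom.app X ≫ e.hom.app ((tateZ0 k H).obj X) =
        (tateZ0ShiftIso k H).hom.app X)
    (T : Triangle (Tate k H)) (hT : T ∈ distTriang (Tate k H)) :
    (tateZ0 k H).mapTriangle.obj T ∈ relDistTriangles k H e := by
  obtain ⟨S, σ, ⟨i⟩⟩ := (HomotopyCategory.distinguished_iff_iso_trianglehOfDegreewiseSplit _).1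
    ((isTate k H).ι.map_distinguished T hT)
  let i₁ : T.obj₁.obj ≅ (HomotopyCategory.quotient _ _).obj S.X₁ := Triangle.π₁.mapIso i
  let i₂ : T.obj₂.obj ≅ (HomotopyCategory.quotient _ _).obj S.X₂ := Triangle.π₂.mapIso i
  let i₃ : T.obj₃.obj ≅ (HomotopyCategory.quotient _ _).obj S.X₃ := Triangle.π₃.mapIso i
  have h₁ := (isTate k H).prop_of_iso i₁ T.obj₁.property
  have h₃ := (isTate k H).prop_of_iso i₃ T.obj₃.property
  obtain ⟨hw, w, hS, hcw, h⟩ := exists_connecting_cycles σ h₁ h₃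
  rw [relDistTriangles_iff]
  refine ⟨_, w, hS, hcw, ⟨Triangle.isoMk _ _ ((cyclesZero k H).mapIso i₁)
    ((cyclesZero k H).mapIso i₂) ((cyclesZero k H).mapIso i₃) ?_ ?_ ?_⟩⟩
  · have := congrArg (cyclesZero k H).map i.hom.comm₁
    rw [Functor.map_comp, Functor.map_comp] at this
    exact this
  · have := congrArg (cyclesZero k H).map i.hom.comm₂
    rw [Functor.map_comp, Functor.map_comp] at this
    exact this
  · let f : T.obj₁ ⟶ ⟨(HomotopyCategory.quotient _ _).obj S.X₁, h₁⟩ := ObjectProperty.homMk i₁.hom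
    have hf := mor₃_comp_tateShiftIso σ i.hom f rfl
    have hη : (tateZ0 k H).map (f⟦(1 : ℤ)⟧') ≫ (tateZ0ShiftIso k H).hom.app _ =
        (tateZ0ShiftIso k H).hom.app _ ≫ (suspension k H).map ((tateZ0 k H).map f) :=
      (tateZ0ShiftIso k H).hom.naturality f
    refine comp_map_eq_comp_inv_app (F' := suspension k H) (A := (tateZ0 k H).obj T.obj₁)
      (A' := (tateZ0 k H).obj ⟨(HomotopyCategory.quotient _ _).obj S.X₁, h₁⟩)
      (u := (tateZ0 k H).map T.mor₃) (c := ((tateZ0 k H).commShiftIso (1 : ℤ)).hom.app T.obj₁)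
      (a := (tateZ0 k H).map f) (v := (cyclesZero k H).map i₃.hom ≫ (toStMod k H).map w) e
      (he T.obj₁) ?_ |>.trans (Category.assoc _ _ _)
    exact (congrArg (_ ≫ ·) hη.symm).trans ((map_comp_map_comp_map (cyclesZero k H) hf
      ((toStMod k H).map (cyclesShiftToCosyzygy k H h₁))).trans (congrArg (_ ≫ ·) h))

end

end RelStable

/-! ### The main theorem -/

open RelStable in
theorem mainTheorem4 {p : ℕ} [Fact p.Prime] {k : Type u} [Field k] [Algebra (ZMod p) k]
    [IsAlgClosure (ZMod p) k] {G : Type u} [Group G] [Finite G] (H : Subgroup G) :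
    ∃ (_ : HasShift (RelStable.StMod k H) ℤ)
      (_ : ∀ n : ℤ, (shiftFunctor (RelStable.StMod k H) n).Additive)
      (_ : Pretriangulated (RelStable.StMod k H))
      (e : shiftFunctor (RelStable.StMod k H) (1 : ℤ) ≅ RelStable.suspension k H)
      (_ : (RelStable.tateZ0 k H).CommShift ℤ),
      (distTriang (RelStable.StMod k H)) = RelStable.relDistTriangles k H e ∧
      IsTriangulated (RelStable.StMod k H) ∧
      (RelStable.tateZ0 k H).IsTriangulated ∧
      (RelStable.tateZ0 k H).IsEquivalence := by
  obtain ⟨_, _, _, _, h₁, h₂⟩ := exists_pretriangulated_of_equivalence (tateZ0 k H)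
  obtain ⟨e, he⟩ := exists_shiftFunctor_iso_suspension k H
  have hsub : distTriang (StMod k H) ⊆ relDistTriangles k H e := by
    intro T hT
    obtain ⟨T', i, hT'⟩ := ((tateZ0 k H).distTriang_iff T).1 hT
    obtain ⟨S, w, hS, hw, ⟨j⟩⟩ := (relDistTriangles_iff e _).1
      (mapTriangle_mem_relDistTriangles e he T' hT')
    exact (relDistTriangles_iff e _).2 ⟨S, w, hS, hw, ⟨i ≪≫ j⟩⟩
  refine ⟨inferInstance, inferInstance, inferInstance, e, inferInstance, ?_, h₁, h₂,
    inferInstance⟩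
  refine hsub.antisymm fun T hT => ?_
  obtain ⟨S, w, hS, hw, ⟨i⟩⟩ := (relDistTriangles_iff e T).1 hT
  refine isomorphic_distinguished _ ?_ _ i
  -- Any transported triangle on `S.f` is standard by `hsub`, and its first map is isomorphic to
  -- that of the given standard triangle, which is therefore distinguished too.
  obtain ⟨Z, g, h, hT'⟩ := distinguished_cocone_triangle ((toStMod k H).map S.f)
  obtain ⟨S', w', hS', hw', ⟨i'⟩⟩ := (relDistTriangles_iff e _).1 (hsub hT')
  exact relTriangle_distinguished_of_iso e hS hw hS' hw'
    (isomorphic_distinguished _ hT' _ i'.symm) (Triangle.π₁.mapIso i') (Triangle.π₂.mapIso i')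
    i'.hom.comm₁
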